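/- Let $S=\{a_n\}_{n\in\mathbb N}$ be a sequence of complex numbers with $0<|a_1|\le|a_2|\le\cdots\to\infty$, with finite exponent of convergence $\alpha=\limsup_{n\to\infty}\frac{\ln n}{\ln|a_n|}$, and such that for some $\Psi\in[-\pi,\pi)$ and $\varepsilon>0$ no $a_n$ lies in the sector $\mathcal S=\{re^{i\theta}: r>0,\ |\theta-\Psi|<\varepsilon\}$. Put $\zeta_S(s)=\sum_{n=1}^\infty a_n^{-s}$ for $\Re(s)>\alpha$, where $a_n^{-s}$ is defined with $\arg a_n\in(\Psi-2\pi,\Psi)$. Let $F$ be an entire function whose zeros, counted with multiplicity, are exactly the $a_n$, and whose growth order is at most $\alpha$ (the least possible order). Let $m\in\mathbb N$, $M,N\in\mathbb N_0$, $\delta>0$ with $N/m>\alpha-\delta$, and suppose that some branch of $\ln F$ that is holomorphic in $\mathcal S$ satisfies $$\ln F(z)=\sum_{j=0}^N\sum_{k=0}^M d_{j,k}\,z^{\alpha-(j/m)}\ln^k z+o\big(z^{\alpha-(N/m)-\delta}\big),\qquad z\to\infty,\ z\in\mathcal S,$$ with complex coefficients $d_{j,k}$, where $\ln z$ and the powers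 of $z$ are taken with $\arg z\in(\Psi-\varepsilon,\Psi+\varepsilon)$. Then $\zeta_S$ has a meromorphic continuation to the half-plane $\Re(s)>\alpha-(N/m)-\delta$, and for every $j\in\{0,\dots,N\}$ its residue (which is $0$ at a regular point) at $s=\alpha-(j/m)=:\beta_j$ is $$\operatorname{Res}[\zeta_S(s);\,s=\beta_j]=\frac{\Theta(M)}{2\pi i}\,d_{j,0}\,\beta_j\left(e^{2\pi i\beta_j}-1\right)+\frac{\Theta(M-1)}{2\pi i}\,d_{j,1}\left[(2\pi i\beta_j+1)e^{2\pi i\beta_j}-1\right]+\frac{\Theta(M-2)}{2\pi i}\sum_{k=2}^M d_{j,k}(2\pi i)^{k-1}e^{2\pi i\beta_j}\left[2\pi i\beta_j+k\right],$$ where $\Theta(x)=1$ for $x\ge0$ and $\Theta(x)=0$ for $x<0$. In particular, if $M\ge2$ and $\alpha-(j'/m)=0$ for some $j'\in\{0,\dots,N\}$, then $$\operatorname{Res}[\zeta_S(s);\,s=0]=\sum_{k=2}^M d_{j',k}\,(2\pi i)^{k-2}\,k .$$ -/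

import Mathlib

namespace ZetaSeq

open Filter Topology Complex

/-- The branch of the complex logarithm with imaginary part in `(θ - π, θ + π]`, that is,
with branch cut along the ray opposite to the direction `θ`. -/
noncomputable def argLog (θ : ℝ) (z : ℂ) : ℂ :=
  Complex.log (z * Complex.exp (-(θ * Complex.I))) + θ * Complex.I

/-- The open sector of half-opening `ε` around the ray `{t e^{iΨ} : t > 0}`; arguments are
understood modulo `2π`. -/
def sector (Ψ ε : ℝ) : Set ℂ :=
  {z | ∃ r θ : ℝ, 0 < r ∧ |θ - Ψ| < ε ∧ z = r * Complex.exp (θ * Complex.I)}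

/-- The sequences considered; the `n`-th term (`n ≥ 1`) of the sequence is `a (n - 1)`. -/
structure IsZetaSequence (a : ℕ → ℂ) (α Ψ ε : ℝ) : Prop where
  first_ne_zero : 0 < ‖a 0‖
  norm_monotone : Monotone fun n => ‖a n‖
  norm_tendsto : Tendsto (fun n => ‖a n‖) atTop atTop
  /-- the exponent of convergence is finite and equals `α` -/
  exponent_eq :
    limsup (fun n : ℕ => ((Real.log ((n : ℝ) + 1) / Real.log ‖a n‖ : ℝ) : EReal)) atTop
      = (α : EReal)
  angle_mem : Ψ ∈ Set.Ico (-Real.pi) Real.pi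
  eps_pos : 0 < ε
  notMem_sector : ∀ n, a n ∉ sector Ψ ε

/-- `z ^ (-s)` for the branch with `arg z ∈ (Ψ - 2π, Ψ)` off the cut `{t e^{iΨ} : t ≥ 0}`. -/
noncomputable def cutPowNeg (Ψ : ℝ) (z s : ℂ) : ℂ :=
  Complex.exp (-s * argLog (Ψ - Real.pi) z)

/-- The growth order of an entire function: the infimum of all `q ≥ 0` such that
`F z = O (exp (|z| ^ q))` as `z → ∞` (and `⊤` if there is no such `q`). -/
noncomputable def growthOrder (F : ℂ → ℂ) : EReal :=
  sInf {p : EReal | ∃ q : ℝ, 0 ≤ q ∧ p = (q : EReal) ∧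
    F =O[Bornology.cobounded ℂ] fun z => Real.exp (‖z‖ ^ q)}

/-- `F` is a characteristic function of minimal order of the sequence `a` with exponent of
convergence `α`: it is entire, its zeros counted with multiplicity are the terms of `a`, and its
order is at most `α` (an entire function with these zeros cannot have a smaller order). -/
structure IsCharacteristicFunction (a : ℕ → ℂ) (α : ℝ) (F : ℂ → ℂ) : Prop where
  entire : Differentiable ℂ F
  zeros : ∀ z, analyticOrderAt F z = {n | a n = z}.encard
  order_le : growthOrder F ≤ (α : EReal)

/-- Some holomorphic branch of `log F` in the sector around the cut has the expansion
`∑_{j ≤ N} ∑_{k ≤ M} d_{j,k} z^{α - j/m} (log z)^k + o(z^{α - N/m - δ})` as `z → ∞` in the sector.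
There `log z` and the powers of `z` are taken with `arg z ∈ (Ψ - ε, Ψ + ε)`. -/
structure HasLogExpansion (F : ℂ → ℂ) (α Ψ ε : ℝ) (m M N : ℕ) (d : ℕ → ℕ → ℂ) (δ : ℝ) :
    Prop where
  delta_pos : 0 < δ
  lt_div : α - δ < (N : ℝ) / m
  expansion : ∃ L : ℂ → ℂ, DifferentiableOn ℂ L (sector Ψ ε) ∧
    (∀ z ∈ sector Ψ ε, Complex.exp (L z) = F z) ∧
    (fun z => L z - ∑ j ∈ Finset.range (N + 1), ∑ k ∈ Finset.range (M + 1),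
        d j k * Complex.exp (((α - (j : ℝ) / m : ℝ) : ℂ) * argLog Ψ z) * argLog Ψ z ^ k)
      =o[Bornology.cobounded ℂ ⊓ 𝓟 (sector Ψ ε)]
        fun z => ‖z‖ ^ (α - (N : ℝ) / m - δ)

/-- `Z` is a meromorphic continuation of `ζ_S(s) = ∑ a_n ^ (-s)`, `Re s > α`, to the half-plane
`Re s > σ`. -/
structure IsZetaContinuation (a : ℕ → ℂ) (α Ψ σ : ℝ) (Z : ℂ → ℂ) : Prop where
  meromorphic : MeromorphicOn Z {s | σ < s.re}
  hasSum : ∀ s : ℂ, α < s.re → HasSum (fun n => cutPowNeg Ψ (a n) s) (Z s)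

/-- `c` is the residue of `f` at the isolated singularity `z₀`. -/
def HasResidueAt (f : ℂ → ℂ) (z₀ c : ℂ) : Prop :=
  ∀ᶠ r : ℝ in 𝓝[>] 0,
    (2 * (Real.pi : ℂ) * Complex.I)⁻¹ * (∮ z in C(z₀, r), f z) = c

/-- The Heaviside step function with `Θ(0) = 1`. -/
noncomputable def heaviside (x : ℝ) : ℂ := if 0 ≤ x then 1 else 0

/-- The explicit residue at `b = α - j/m` in terms of `c k = d_{j,k}`, `0 ≤ k ≤ M`. -/
noncomputable def residueFormula (M : ℕ) (c : ℕ → ℂ) (b : ℂ) : ℂ :=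
  heaviside M / (2 * Real.pi * Complex.I) * c 0 * b *
      (Complex.exp (2 * Real.pi * Complex.I * b) - 1)
    + heaviside ((M : ℝ) - 1) / (2 * Real.pi * Complex.I) * c 1 *
      ((2 * Real.pi * Complex.I * b + 1) * Complex.exp (2 * Real.pi * Complex.I * b) - 1)
    + heaviside ((M : ℝ) - 2) / (2 * Real.pi * Complex.I) *
      ∑ k ∈ Finset.Icc 2 M, c k * (2 * Real.pi * Complex.I) ^ (k - 1) *
        Complex.exp (2 * Real.pi * Complex.I * b) * (2 * Real.pi * Complex.I * b + k)

end ZetaSeq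

/-! ### Sector geometry, branches of the logarithm, and convergence. -/

namespace ZetaSeq

open Filter Topology Complex

/-! Integrate `z ^ (-s) F'(z) / F(z)` over a keyhole contour around the cut `{t e^{iΨ}}`. Since `z ^
(-s)` gains the factor `e^{2πis}` from one side of the cut to the other, the residue theorem gives,
for `Re s` large, `2πi ζ_S(s) = (e^{2πis} - 1) ∫_ray z ^ (-s) F'/F dz - ∫_arc z ^ (-s) F'/F dz`,
where the ray starts at a small radius and the arc is the corresponding small circle; the arc term
is entire in `s`. This is `exists_tendsto_keyhole`.

The large circle need not avoid the zeros. At radius `R`, split off the zeros with `|a_n| ≤ 2R`: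
there are `O(R ^ q)` of them, and by the maximum principle and Borel–Carathéodory the zero-free
cofactor has logarithmic derivative `O(R ^ q)` on `|z| ≤ R` (`exists_logDeriv_eq`). Each pole `1 /
(z - a_n)` contributes `2πi a_n ^ (-s)` up to `O(R ^ (-Re s))`, uniformly in `n`
(`exists_norm_keyhole_sub_le`). The total error tends to `0` for `Re s > q + 1`.

Integration by parts turns the ray integral into `s ∫ z ^ (-s - 1) ln F dz` plus an entire term. A
term `d z ^ β ln ^ k z` of the expansion yields `d k! / (s - β) ^ (k + 1)` plus an entire function,
and the remainder yields a function holomorphic for `Re s > α - N/m - δ`. With `h(s) = s (e^{2πis} -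
1)`, therefore, `ζ_S(s) = A(s) + (2πi)⁻¹ ∑ d_{j,k} k! h(s) / (s - β_j) ^ (k + 1)` with `A`
holomorphic (`exists_tsum_eq_add_principal`). The residue at `β_j` is `(2πi)⁻¹ ∑ d_{j,k}
h^{(k)}(β_j)`. The identity theorem carries this to `Re s > α` and to every meromorphic
continuation. -/

/-- The sector is invariant under positive dilations, so a disc around `e^{iΨ}` can be rescaled.
Consequently every `a n` stays at distance at least `c t` from the point `t e^{iΨ}` of the cut. -/
theorem exists_cone_subset_sector (Ψ : ℝ) {ε : ℝ} (hε : 0 < ε) :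
    ∃ c : ℝ, 0 < c ∧ ∀ t : ℝ, 0 < t → ∀ z : ℂ, ‖z - t * exp (Ψ * I)‖ < c * t →
      z ∈ sector Ψ ε := by
  have h0 : exp (Ψ * I) * exp (-(Ψ * I)) = 1 := by rw [← exp_add]; simp
  have hc : ContinuousAt (fun u : ℂ => arg (u * exp (-(Ψ * I)))) (exp (Ψ * I)) := by
    refine ContinuousAt.comp (g := arg) (f := fun u : ℂ => u * exp (-(Ψ * I))) ?_ (by fun_prop)
    rw [h0]
    exact continuousAt_arg one_mem_slitPlane
  have h1 : ∀ᶠ u in 𝓝 (exp (Ψ * I)), |arg (u * exp (-(Ψ * I)))| < ε := by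
    have := hc.abs.eventually_lt (continuousAt_const (y := ε)) (by simpa [h0] using hε)
    simpa using this
  have h2 : ∀ᶠ u in 𝓝 (exp (Ψ * I)), u ≠ 0 :=
    isOpen_ne.mem_nhds (exp_ne_zero _)
  obtain ⟨c, hc0, hc⟩ := Metric.eventually_nhds_iff.1 (h1.and h2)
  refine ⟨c, hc0, fun t ht z hz => ?_⟩
  have ht' : (t : ℂ) ≠ 0 := by exact_mod_cast ht.ne'
  have hu := hc (y := z / t) (by
    rw [dist_eq_norm]
    have : z / t - exp (Ψ * I) = (z - t * exp (Ψ * I)) / t := by field_simp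
    rw [this, norm_div, norm_real, Real.norm_of_nonneg ht.le, div_lt_iff₀ ht]
    exact hz)
  set θ := arg (z / t * exp (-(Ψ * I)))
  refine ⟨t * ‖z / t‖, Ψ + θ, mul_pos ht (norm_pos_iff.2 hu.2), by simpa using hu.1, ?_⟩
  have h3 := norm_mul_exp_arg_mul_I (z / t * exp (-(Ψ * I)))
  have h4 : ‖exp (-(Ψ * I))‖ = 1 := by
    rw [← neg_mul, ← ofReal_neg]; exact norm_exp_ofReal_mul_I _
  rw [norm_mul, h4, mul_one] at h3
  have h5 : z = t * (z / t * exp (-(Ψ * I)) * exp (Ψ * I)) := by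
    rw [mul_assoc, mul_comm (exp _), h0]; field_simp
  conv_lhs => rw [h5, ← h3]
  push_cast
  rw [add_mul, exp_add]
  ring

theorem exp_mem_sector (Ψ x : ℝ) {ε : ℝ} (hε : 0 < ε) : exp (x + Ψ * I) ∈ sector Ψ ε :=
  ⟨Real.exp x, Ψ, Real.exp_pos x, by simpa using hε, by rw [exp_add, ofReal_exp]⟩

theorem sector_mem_nhds_exp (Ψ x : ℝ) {ε : ℝ} (hε : 0 < ε) :
    sector Ψ ε ∈ 𝓝 (exp (x + Ψ * I)) := by
  obtain ⟨c, hc, h⟩ := exists_cone_subset_sector Ψ hε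
  refine Metric.mem_nhds_iff.2 ⟨c * Real.exp x, by positivity, fun z hz => ?_⟩
  refine h (Real.exp x) (Real.exp_pos x) z ?_
  rw [Metric.mem_ball, dist_eq_norm, exp_add] at hz
  simpa using hz

theorem argLog_exp (Ψ x : ℝ) : argLog Ψ (exp (x + Ψ * I)) = x + Ψ * I := by
  rw [argLog, ← exp_add]
  congr 1
  have : (x : ℂ) + Ψ * I + -(Ψ * I) = x := by ring
  rw [this, log_exp] <;> simp [Real.pi_pos, Real.pi_pos.le]

theorem exp_argLog (θ : ℝ) {z : ℂ} (hz : z ≠ 0) : exp (argLog θ z) = z := by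
  rw [argLog, exp_add, exp_log (mul_ne_zero hz (exp_ne_zero _)), mul_assoc, ← exp_add]
  simp

theorem argLog_re (θ : ℝ) (z : ℂ) : (argLog θ z).re = Real.log ‖z‖ := by
  rw [argLog, add_re, log_re, norm_mul, ← neg_mul, ← ofReal_neg, norm_exp_ofReal_mul_I]
  simp

theorem argLog_im_mem (θ : ℝ) (z : ℂ) : (argLog θ z).im ∈ Set.Ioc (θ - Real.pi) (θ + Real.pi) := by
  rw [argLog, add_im, log_im]
  have := arg_mem_Ioc (z * exp (-(θ * I)))
  simp only [mul_im, ofReal_re, I_im, ofReal_im, I_re, Set.mem_Ioc] at *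
  constructor <;> linarith [this.1, this.2]

theorem argLog_im_mem_Ioo {Ψ ε : ℝ} (hε : 0 < ε) {z : ℂ} (hz : z ≠ 0) (hz' : z ∉ sector Ψ ε) :
    (argLog (Ψ - Real.pi) z).im ∈ Set.Ioo (Ψ - 2 * Real.pi) Ψ := by
  obtain ⟨h1, h2⟩ := argLog_im_mem (Ψ - Real.pi) z
  rw [sub_add_cancel] at h2
  refine ⟨by linarith, lt_of_le_of_ne h2 fun h => hz' ?_⟩
  have h3 := exp_argLog (Ψ - Real.pi) hz
  rw [← re_add_im (argLog (Ψ - Real.pi) z), h] at h3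
  rw [← h3]
  exact exp_mem_sector Ψ _ hε

theorem norm_cutPowNeg_le {Ψ : ℝ} (hΨ : Ψ ∈ Set.Ico (-Real.pi) Real.pi) {z : ℂ} (hz : z ≠ 0)
    (s : ℂ) : ‖cutPowNeg Ψ z s‖ ≤ ‖z‖ ^ (-s.re) * Real.exp (3 * Real.pi * |s.im|) := by
  have hp := norm_pos_iff.2 hz
  rw [cutPowNeg, norm_exp, Real.rpow_def_of_pos hp, ← Real.exp_add, Real.exp_le_exp]
  have h1 := argLog_re (Ψ - Real.pi) z
  obtain ⟨h2, h3⟩ := argLog_im_mem (Ψ - Real.pi) z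
  -- The argument lies in `(Ψ - 2π, Ψ]` and `-π ≤ Ψ < π`; this is the origin of the constant `3π`
  -- everywhere below.
  have hb : |(argLog (Ψ - Real.pi) z).im| ≤ 3 * Real.pi := by
    rw [abs_le]; constructor <;> linarith [hΨ.1, hΨ.2, Real.pi_pos]
  have h4 : s.im * (argLog (Ψ - Real.pi) z).im ≤ 3 * Real.pi * |s.im| :=
    (le_abs_self _).trans (by rw [abs_mul, mul_comm]; gcongr)
  simp only [mul_re, neg_re, neg_im, h1]
  linarith

variable {a : ℕ → ℂ} {α Ψ ε : ℝ}

theorem IsZetaSequence.norm_pos (ha : IsZetaSequence a α Ψ ε) (n : ℕ) : 0 < ‖a n‖ :=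
  ha.first_ne_zero.trans_le (ha.norm_monotone n.zero_le)

theorem IsZetaSequence.ne_zero (ha : IsZetaSequence a α Ψ ε) (n : ℕ) : a n ≠ 0 :=
  norm_pos_iff.1 (ha.norm_pos n)

/-- For `α < r < q`, eventually `ln (n + 1) < r ln |a n|`, so `|a n| ^ (-q) ≤ (n + 1) ^ (-q / r)`
with `q / r > 1`. -/
theorem IsZetaSequence.summable_rpow (ha : IsZetaSequence a α Ψ ε) {q : ℝ} (hq : α < q) :
    Summable fun n => ‖a n‖ ^ (-q) := by
  obtain ⟨r, hr, hrq⟩ := exists_between hq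
  have h1 : ∀ᶠ n : ℕ in atTop, Real.log ((n : ℝ) + 1) / Real.log ‖a n‖ < r := by
    have : limsup (fun n : ℕ => ((Real.log ((n : ℝ) + 1) / Real.log ‖a n‖ : ℝ) : EReal)) atTop
        < (r : EReal) := by rw [ha.exponent_eq]; exact_mod_cast hr
    filter_upwards [eventually_lt_of_limsup_lt this] with n hn using by exact_mod_cast hn
  have h2 : ∀ᶠ n : ℕ in atTop, 1 < ‖a n‖ := ha.norm_tendsto.eventually_gt_atTop 1
  have h3 := (h1.and h2).and (eventually_ge_atTop 1)
  have hr0 : 0 < r := by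
    obtain ⟨n, ⟨hn1, hn2⟩, hn3⟩ := h3.exists
    have : (1 : ℝ) ≤ n := by exact_mod_cast hn3
    exact lt_of_le_of_lt (div_nonneg (Real.log_nonneg (by linarith)) (Real.log_pos hn2).le) hn1
  have hs : Summable fun n : ℕ => ((n + 1 : ℕ) : ℝ) ^ (-(q / r)) :=
    (summable_nat_add_iff 1).2 (Real.summable_nat_rpow.2 (by
      have := (one_lt_div hr0).2 hrq; linarith))
  refine summable_of_isBigO_nat hs (Asymptotics.IsBigO.of_bound 1 ?_)
  filter_upwards [h3] with n hn
  obtain ⟨⟨hn1, hn2⟩, -⟩ := hn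
  have hn0 : (0 : ℝ) < (n + 1 : ℕ) := by positivity
  have hpos : 0 < ‖a n‖ := ha.norm_pos n
  rw [Real.norm_of_nonneg (by positivity), Real.norm_of_nonneg (by positivity), one_mul,
    Real.rpow_def_of_pos hpos, Real.rpow_def_of_pos hn0, Real.exp_le_exp]
  rw [div_lt_iff₀ (Real.log_pos hn2)] at hn1
  push_cast
  have : Real.log (n + 1) * (q / r) ≤ Real.log ‖a n‖ * q := by
    rw [mul_div_assoc', div_le_iff₀ hr0]
    nlinarith
  linarith

theorem IsZetaSequence.summable_cutPowNeg (ha : IsZetaSequence a α Ψ ε) {s : ℂ} (hs : α < s.re) :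
    Summable fun n => cutPowNeg Ψ (a n) s :=
  Summable.of_norm_bounded ((ha.summable_rpow hs).mul_right _)
    fun n => norm_cutPowNeg_le ha.angle_mem (ha.ne_zero n) s

theorem IsZetaSequence.differentiableOn_tsum (ha : IsZetaSequence a α Ψ ε) :
    DifferentiableOn ℂ (fun s => ∑' n, cutPowNeg Ψ (a n) s) {s | α < s.re} := by
  intro s hs
  obtain ⟨σ, hσ, hσs⟩ := exists_between (show α < s.re from hs)
  set U : Set ℂ := {z | σ < z.re} ∩ {z | |z.im| < |s.im| + 1}
  have hU : IsOpen U := (isOpen_lt continuous_const continuous_re).inter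
    (isOpen_lt continuous_im.abs continuous_const)
  have hsU : s ∈ U := ⟨hσs, by simp⟩
  -- The bound `|a n| ^ (-Re z) ≤ |a n| ^ (-σ)` needs `|a n| ≥ 1`; the finitely many other terms are
  -- treated separately.
  obtain ⟨n₀, hn₀⟩ := (ha.norm_tendsto.eventually_ge_atTop 1).exists_forall_of_atTop
  have hd : DifferentiableOn ℂ (fun z => ∑' n, cutPowNeg Ψ (a (n + n₀)) z) U := by
    refine differentiableOn_tsum_of_summable_norm
      (((summable_nat_add_iff n₀).2 (ha.summable_rpow hσ)).mul_right
        (Real.exp (3 * Real.pi * (|s.im| + 1)))) (fun n => ?_) hU fun n z hz => ?_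
    · unfold cutPowNeg; fun_prop
    · refine (norm_cutPowNeg_le ha.angle_mem (ha.ne_zero _) z).trans ?_
      have := hz.1
      have := hz.2
      simp only [Set.mem_ofPred_eq] at *
      have := Real.pi_pos
      gcongr
      exact hn₀ _ (by omega)
  have hd2 : DifferentiableOn ℂ (fun z => ∑ n ∈ Finset.range n₀, cutPowNeg Ψ (a n) z) U := by
    unfold cutPowNeg; fun_prop
  refine ((((hd2.add hd).congr fun z hz => ?_).differentiableAt
    (hU.mem_nhds hsU))).differentiableWithinAt
  exact ((ha.summable_cutPowNeg (hσ.trans hz.1)).sum_add_tsum_nat_add n₀).symm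

theorem IsCharacteristicFunction.isBigO {F : ℂ → ℂ} (hF : IsCharacteristicFunction a α F) {q : ℝ}
    (hq : α < q) : F =O[Bornology.cobounded ℂ] fun z => Real.exp (‖z‖ ^ q) := by
  have h : growthOrder F < (q : EReal) := hF.order_le.trans_lt (by exact_mod_cast hq)
  obtain ⟨p, ⟨r, -, rfl, hr⟩, hpq⟩ := sInf_lt_iff.1 h
  have hrq : r < q := by exact_mod_cast hpq
  refine hr.trans (Asymptotics.IsBigO.of_bound 1 ?_)
  filter_upwards [tendsto_norm_cobounded_atTop.eventually_ge_atTop 1] with z hz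
  rw [Real.norm_of_nonneg (Real.exp_pos _).le, Real.norm_of_nonneg (Real.exp_pos _).le, one_mul,
    Real.exp_le_exp]
  exact Real.rpow_le_rpow_of_exponent_le hz hrq.le

end ZetaSeq

/-! ### The keyhole contour in logarithmic coordinates. -/

namespace ZetaSeq

open Filter Topology Complex

/-- The integral of `z ^ (-s) f z` along the ray `z = e^{x + iΨ}`, `x₀ ≤ x ≤ X`. -/
noncomputable def rayIntegral (Ψ x₀ X : ℝ) (s : ℂ) (f : ℂ → ℂ) : ℂ :=
  ∫ x : ℝ in x₀..X, exp ((1 - s) * (x + Ψ * I)) * f (exp (x + Ψ * I))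

/-- The integral of `z ^ (-s) f z` along the circle `z = e^{X + iy}`, `Ψ - 2π ≤ y ≤ Ψ`. -/
noncomputable def arcIntegral (Ψ X : ℝ) (s : ℂ) (f : ℂ → ℂ) : ℂ :=
  I * ∫ y : ℝ in (Ψ - 2 * Real.pi)..Ψ, exp ((1 - s) * (X + y * I)) * f (exp (X + y * I))

theorem integral_lower_ray (Ψ x₀ X : ℝ) (s : ℂ) (f : ℂ → ℂ) :
    ∫ x : ℝ in x₀..X, exp ((1 - s) * (x + (Ψ - 2 * Real.pi : ℝ) * I)) *
      f (exp (x + (Ψ - 2 * Real.pi : ℝ) * I)) =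
    exp (2 * Real.pi * I * s) * rayIntegral Ψ x₀ X s f := by
  rw [rayIntegral, ← intervalIntegral.integral_const_mul]
  refine intervalIntegral.integral_congr fun x _ => ?_
  have h1 : (x : ℂ) + (Ψ - 2 * Real.pi : ℝ) * I = (x + Ψ * I) - 2 * Real.pi * I := by
    push_cast; ring
  have h2 : (1 - s) * ((x : ℂ) + (Ψ - 2 * Real.pi : ℝ) * I)
      = (2 * Real.pi * I * s + (1 - s) * (x + Ψ * I)) - 2 * Real.pi * I := by
    push_cast; ring
  rw [h2, h1, exp_periodic.sub_eq, exp_periodic.sub_eq, exp_add, mul_assoc]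

/-- Under `z = e^w` the keyhole is the boundary of the rectangle `[x₀, X] × [Ψ - 2π, Ψ]`, where `z ^
(-s)` is single-valued. Its two horizontal sides combine into `e^{2πis} - 1` times the ray integral,
and Cauchy's theorem applies. -/
theorem keyhole_of_differentiableOn {Ψ x₀ X ρ : ℝ} (hX : x₀ ≤ X) (hρ : Real.exp X < ρ) (s : ℂ)
    {f : ℂ → ℂ} (hf : DifferentiableOn ℂ f (Metric.ball 0 ρ)) :
    (exp (2 * Real.pi * I * s) - 1) * rayIntegral Ψ x₀ X s f - arcIntegral Ψ x₀ s f
      = - arcIntegral Ψ X s f := by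
  have h := integral_boundary_rect_eq_zero_of_differentiableOn
    (fun w => exp ((1 - s) * w) * f (exp w)) ⟨x₀, Ψ - 2 * Real.pi⟩ ⟨X, Ψ⟩ (by
      refine DifferentiableOn.mul (by fun_prop) ?_
      refine hf.comp (by fun_prop) fun w hw => ?_
      rw [mem_ball_zero_iff, norm_exp]
      have h1 : w.re ∈ Set.uIcc x₀ X := hw.1
      rw [Set.uIcc_of_le hX] at h1
      exact (Real.exp_le_exp.2 h1.2).trans_lt hρ)
  simp only [smul_eq_mul] at h
  rw [integral_lower_ray] at h
  change _ - rayIntegral Ψ x₀ X s f + arcIntegral Ψ X s f - arcIntegral Ψ x₀ s f = 0 at h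
  linear_combination h

theorem arcIntegral_zero_eq_circleIntegral (Ψ X : ℝ) (f : ℂ → ℂ) :
    arcIntegral Ψ X 0 f = ∮ z in C(0, Real.exp X), f z := by
  have hper : Function.Periodic
      (fun y : ℝ => exp ((1 - 0) * (X + y * I)) * f (exp (X + y * I))) (2 * Real.pi) := by
    intro y
    have : (X : ℂ) + (y + 2 * Real.pi : ℝ) * I = X + y * I + 2 * Real.pi * I := by push_cast; ring
    simp only [sub_zero, one_mul]
    rw [this, exp_periodic]
  rw [arcIntegral, circleIntegral]
  have h := hper.intervalIntegral_add_eq (Ψ - 2 * Real.pi) 0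
  rw [sub_add_cancel, zero_add] at h
  rw [h, ← intervalIntegral.integral_const_mul]
  refine intervalIntegral.integral_congr fun y _ => ?_
  simp only [deriv_circleMap, smul_eq_mul, circleMap, zero_add, sub_zero, one_mul, exp_add,
    ofReal_exp]
  ring

/-- The pole is removed by subtracting the same integrand at `s = 0`, weighted by `e^{-sl}`: the
function `e^w (e^{-sw} - e^{-sl}) / (e^w - e^l)` is holomorphic on the rectangle. At `s = 0` the ray
terms cancel and the arcs are honest circle integrals of `1 / (z - e^l)`. -/
theorem keyhole_inv_sub {Ψ x₀ X : ℝ} (s : ℂ) {l : ℂ} (h1 : x₀ < l.re) (h2 : l.re < X)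
    (h3 : l.im ∈ Set.Ioo (Ψ - 2 * Real.pi) Ψ) :
    (exp (2 * Real.pi * I * s) - 1) * rayIntegral Ψ x₀ X s (fun z => (z - exp l)⁻¹)
      - arcIntegral Ψ x₀ s (fun z => (z - exp l)⁻¹)
      = 2 * Real.pi * I * exp (-s * l) - arcIntegral Ψ X s (fun z => (z - exp l)⁻¹) := by
  have hX : x₀ ≤ X := (h1.trans h2).le
  have hP : Ψ - 2 * Real.pi ≤ Ψ := by linarith [Real.pi_pos]
  set E : ℂ → ℂ := fun u => exp (-s * u)
  set K : Set ℂ := Set.uIcc x₀ X ×ℂ Set.uIcc (Ψ - 2 * Real.pi) Ψ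
  -- As `l.im` is strictly interior to an interval of length `2π`, no other preimage of `e^l` lies
  -- in the closed rectangle.
  have hinj : ∀ w ∈ K, exp w = exp l → w = l := by
    intro w hw h
    obtain ⟨n, hn⟩ := exp_eq_exp_iff_exists_int.1 h
    have hw2 : w.im ∈ Set.uIcc (Ψ - 2 * Real.pi) Ψ := hw.2
    rw [Set.uIcc_of_le hP] at hw2
    have h4 := congrArg im hn
    simp at h4
    have hp := Real.pi_pos
    have h5 : (n : ℝ) < 1 := by
      by_contra! hc
      nlinarith [hw2.1, hw2.2, h3.1, h3.2]
    have h6 : (-1 : ℝ) < n := by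
      by_contra! hc
      nlinarith [hw2.1, hw2.2, h3.1, h3.2]
    have h7 : n = 0 := by
      have : n < 1 := by exact_mod_cast h5
      have : -1 < n := by exact_mod_cast h6
      omega
    rw [hn, h7]; simp
  have hne : ∀ w ∈ K, dslope exp l w ≠ 0 := by
    intro w hw
    by_cases hwl : w = l
    · rw [hwl, dslope_same]; simp
    · rw [dslope_of_ne _ hwl, slope_def_field]
      exact div_ne_zero (sub_ne_zero.2 fun h => hwl (hinj w hw h)) (sub_ne_zero.2 hwl)
  have hds : ∀ f : ℂ → ℂ, Differentiable ℂ f → Differentiable ℂ (dslope f l) := fun f hf =>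
    differentiableOn_univ.1 ((differentiableOn_dslope univ_mem).2 hf.differentiableOn)
  -- A quotient of two `dslope`s fills in the removable singularity at `l`: the factors `w - l`
  -- cancel, and the denominator vanishes nowhere on `K`.
  have h := integral_boundary_rect_eq_zero_of_differentiableOn
    (fun w => exp w * (dslope E l w / dslope exp l w)) ⟨x₀, Ψ - 2 * Real.pi⟩ ⟨X, Ψ⟩ (by
      refine DifferentiableOn.mul (by fun_prop) ?_
      exact DifferentiableOn.div (hds _ (by fun_prop)).differentiableOn
        (hds _ (by fun_prop)).differentiableOn hne)
  have key : ∀ (γ : ℝ → ℂ) (p q : ℝ), Continuous γ → (∀ x ∈ Set.uIcc p q, γ x ∈ K ∧ γ x ≠ l) →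
      ∫ x in p..q, exp (γ x) * (dslope E l (γ x) / dslope exp l (γ x)) =
      (∫ x in p..q, exp ((1 - s) * γ x) * (exp (γ x) - exp l)⁻¹) -
        exp (-s * l) * ∫ x in p..q, exp ((1 - 0) * γ x) * (exp (γ x) - exp l)⁻¹ := by
    intro γ p q hγ hm
    have hc : ContinuousOn (fun x => (exp (γ x) - exp l)⁻¹) (Set.uIcc p q) := by
      refine ContinuousOn.inv₀ (by fun_prop) fun x hx => sub_ne_zero.2 fun he => ?_
      exact (hm x hx).2 (hinj _ (hm x hx).1 he)
    have hint : ∀ t : ℂ, IntervalIntegrable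
        (fun x => exp ((1 - t) * γ x) * (exp (γ x) - exp l)⁻¹) MeasureTheory.volume p q := fun t =>
      ContinuousOn.intervalIntegrable (ContinuousOn.mul (by fun_prop) hc)
    rw [← intervalIntegral.integral_const_mul, ← intervalIntegral.integral_sub
      (hint s) ((hint 0).const_mul _)]
    refine intervalIntegral.integral_congr fun x hx => ?_
    obtain ⟨hxK, hxl⟩ := hm x hx
    have hx1 : exp (γ x) - exp l ≠ 0 := sub_ne_zero.2 fun he => hxl (hinj _ hxK he)
    have hx2 : γ x - l ≠ 0 := sub_ne_zero.2 hxl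
    simp only [dslope_of_ne _ hxl, slope_def_field, E]
    have he : exp ((1 - s) * γ x) = exp (γ x) * exp (-s * γ x) := by rw [← exp_add]; ring_nf
    rw [he, sub_zero, one_mul]
    field_simp
  simp only [smul_eq_mul] at h
  have memK : ∀ x y : ℝ, x ∈ Set.uIcc x₀ X → y ∈ Set.uIcc (Ψ - 2 * Real.pi) Ψ →
      (x + y * I : ℂ) ∈ K := fun x y hx hy => ⟨by simpa using hx, by simpa using hy⟩
  rw [key (fun x : ℝ => (x : ℂ) + (Ψ - 2 * Real.pi : ℝ) * I) x₀ X (by fun_prop) fun x hx =>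
      ⟨memK _ _ hx Set.left_mem_uIcc, fun he => h3.1.ne (by simp [← he])⟩,
    key (fun x : ℝ => (x : ℂ) + Ψ * I) x₀ X (by fun_prop) fun x hx =>
      ⟨memK _ _ hx Set.right_mem_uIcc, fun he => h3.2.ne (by simp [← he])⟩,
    key (fun y : ℝ => (X : ℂ) + y * I) (Ψ - 2 * Real.pi) Ψ (by fun_prop) fun x hx =>
      ⟨memK _ _ Set.right_mem_uIcc hx, fun he => h2.ne (by simp [← he])⟩,
    key (fun y : ℝ => (x₀ : ℂ) + y * I) (Ψ - 2 * Real.pi) Ψ (by fun_prop) fun x hx =>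
      ⟨memK _ _ Set.left_mem_uIcc hx, fun he => h1.ne (by simp [← he])⟩] at h
  have e1 := integral_lower_ray Ψ x₀ X s (fun z => (z - exp l)⁻¹)
  have e2 := integral_lower_ray Ψ x₀ X 0 (fun z => (z - exp l)⁻¹)
  have e3 : arcIntegral Ψ X 0 (fun z => (z - exp l)⁻¹) = 2 * Real.pi * I := by
    rw [arcIntegral_zero_eq_circleIntegral]
    refine circleIntegral.integral_sub_inv_of_mem_ball ?_
    rw [mem_ball_zero_iff, norm_exp]
    exact Real.exp_lt_exp.2 h2
  have e4 : arcIntegral Ψ x₀ 0 (fun z => (z - exp l)⁻¹) = 0 := by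
    rw [arcIntegral_zero_eq_circleIntegral]
    refine circleIntegral_eq_zero_of_differentiable_on_off_countable (Real.exp_pos _).le
      Set.countable_empty ?_ ?_
    · refine ContinuousOn.inv₀ (by fun_prop) fun z hz => sub_ne_zero.2 ?_
      rintro rfl
      rw [mem_closedBall_zero_iff, norm_exp, Real.exp_le_exp] at hz
      linarith
    · intro z hz
      refine DifferentiableAt.inv (by fun_prop) (sub_ne_zero.2 ?_)
      rintro rfl
      have := hz.1
      rw [mem_ball_zero_iff, norm_exp, Real.exp_lt_exp] at this
      linarith
  rw [mul_zero, exp_zero, one_mul] at e2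
  simp only [rayIntegral, arcIntegral] at *
  rw [e1, e2] at h
  linear_combination h + exp (-s * l) * e3 - exp (-s * l) * e4

theorem norm_arcIntegral_le {Ψ : ℝ} (hΨ : Ψ ∈ Set.Ico (-Real.pi) Real.pi) (X : ℝ) (s : ℂ)
    {f : ℂ → ℂ} {B : ℝ} (hf : ∀ z, ‖z‖ = Real.exp X → ‖f z‖ ≤ B) :
    ‖arcIntegral Ψ X s f‖ ≤
      2 * Real.pi * Real.exp (3 * Real.pi * |s.im|) * (Real.exp X ^ (1 - s.re) * B) := by
  have hp := Real.pi_pos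
  rw [arcIntegral, norm_mul, norm_I, one_mul]
  have h := intervalIntegral.norm_integral_le_of_norm_le_const
    (a := Ψ - 2 * Real.pi) (b := Ψ)
    (f := fun y : ℝ => exp ((1 - s) * (X + y * I)) * f (exp (X + y * I)))
    (C := Real.exp (3 * Real.pi * |s.im|) * (Real.exp X ^ (1 - s.re) * B)) (fun y hy => by
      rw [Set.uIoc_of_le (by linarith)] at hy
      rw [norm_mul, norm_exp, ← mul_assoc, ← Real.exp_mul, ← Real.exp_add]
      have hb : |y| ≤ 3 * Real.pi := by
        rw [abs_le]; constructor <;> linarith [hy.1, hy.2, hΨ.1, hΨ.2]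
      have h4 : s.im * y ≤ 3 * Real.pi * |s.im| :=
        (le_abs_self _).trans (by rw [abs_mul, mul_comm]; gcongr)
      have h5 : ‖f (exp (X + y * I))‖ ≤ B := hf _ (by simp [norm_exp])
      refine mul_le_mul (Real.exp_le_exp.2 ?_) h5 (norm_nonneg _) (Real.exp_pos _).le
      simp
      linarith)
  refine h.trans (le_of_eq ?_)
  rw [sub_sub_cancel, abs_of_pos (show 0 < 2 * Real.pi by linarith)]
  ring

theorem norm_rayIntegral_le {Ψ : ℝ} (hΨ : Ψ ∈ Set.Ico (-Real.pi) Real.pi) {X Y : ℝ} (hXY : X ≤ Y)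
    {s : ℂ} (hs : 0 ≤ s.re) {f : ℂ → ℂ} {D : ℝ}
    (hf : ∀ x : ℝ, ‖f (exp (x + Ψ * I))‖ ≤ D * Real.exp (-x)) :
    ‖rayIntegral Ψ X Y s f‖ ≤
      D * Real.exp (3 * Real.pi * |s.im|) * Real.exp X ^ (-s.re) * (Y - X) := by
  have hp := Real.pi_pos
  have hD : 0 ≤ D := by
    have := (norm_nonneg _).trans (hf 0)
    simpa using this
  rw [rayIntegral, ← abs_of_nonneg (sub_nonneg.2 hXY)]
  refine intervalIntegral.norm_integral_le_of_norm_le_const fun x hx => ?_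
  rw [Set.uIoc_of_le hXY] at hx
  rw [norm_mul]
  calc _ ≤ ‖exp ((1 - s) * (x + Ψ * I))‖ * (D * Real.exp (-x)) := by gcongr; exact hf x
    _ = D * Real.exp (s.im * Ψ + -s.re * x) := by
      rw [norm_exp, mul_left_comm, ← Real.exp_add]
      congr 2
      simp
      ring
    _ ≤ D * (Real.exp (3 * Real.pi * |s.im|) * Real.exp X ^ (-s.re)) := by
      rw [← Real.exp_mul, ← Real.exp_add]
      have hb : |Ψ| ≤ 3 * Real.pi := by
        rw [abs_le]; constructor <;> linarith [hΨ.1, hΨ.2]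
      have h4 : s.im * Ψ ≤ 3 * Real.pi * |s.im| :=
        (le_abs_self _).trans (by rw [abs_mul, mul_comm]; gcongr)
      refine mul_le_mul_of_nonneg_left (Real.exp_le_exp.2 ?_) hD
      nlinarith [hx.1]
    _ = _ := by ring

end ZetaSeq

/-! ### Splitting off zeros and bounding the logarithmic derivative. -/

namespace ZetaSeq

open Filter Topology Complex

/-- One linear factor is divided out at a time, using `dslope` at a zero. Additivity of analytic
orders shows that exactly the unused indices survive, so repeated terms of the sequence are handled
correctly. -/
theorem exists_eq_prod_mul {a : ℕ → ℂ} (ha : ∀ n, a n ≠ 0) {F : ℂ → ℂ} (hF : Differentiable ℂ F)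
    (hz : ∀ z, analyticOrderAt F z = {n | a n = z}.encard) (T : Finset ℕ) :
    ∃ G : ℂ → ℂ, Differentiable ℂ G ∧ (∀ z, F z = (∏ n ∈ T, (1 - z / a n)) * G z) ∧
      ∀ z, analyticOrderAt G z = {n | n ∉ T ∧ a n = z}.encard := by
  induction T using Finset.induction_on with
  | empty => exact ⟨F, hF, by simp, by simpa using hz⟩
  | insert k T hk ih =>
    obtain ⟨G, hG, hFG, hGz⟩ := ih
    have hGk : G (a k) = 0 := by
      have : analyticOrderAt G (a k) ≠ 0 := by
        rw [hGz, Set.encard_ne_zero]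
        exact ⟨k, hk, rfl⟩
      exact (analyticOrderAt_ne_zero.1 this).2
    have hD : Differentiable ℂ (dslope G (a k)) :=
      differentiableOn_univ.1 ((differentiableOn_dslope univ_mem).2 hG.differentiableOn)
    have hGG : ∀ z, G z = (1 - z / a k) * (-a k * dslope G (a k) z) := by
      intro z
      have h1 := sub_smul_dslope G (a k) z
      rw [hGk, sub_zero, smul_eq_mul] at h1
      rw [← h1]
      have := ha k
      field_simp
      ring
    refine ⟨fun z => -a k * dslope G (a k) z, hD.const_mul _, fun z => ?_, fun z => ?_⟩
    · rw [hFG, Finset.prod_insert hk, hGG]; ring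
    · have ho := hGz z
      have hlin : AnalyticAt ℂ (fun z => 1 - z / a k) z := by fun_prop
      have hG' : AnalyticAt ℂ (fun z => -a k * dslope G (a k) z) z := (hD.const_mul _).analyticAt z
      rw [show G = (fun z => 1 - z / a k) * fun z => -a k * dslope G (a k) z from
        funext hGG, analyticOrderAt_mul hlin hG'] at ho
      by_cases hzk : a k = z
      · have h1 : analyticOrderAt (fun z => 1 - z / a k) z = 1 := by
          have := analyticOrderAt_eq_nat_iff_iteratedDeriv_eq_zero (n := 1) hlin
          refine this.2 ⟨fun i hi => ?_, ?_⟩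
          · obtain rfl : i = 0 := by omega
            simp [← hzk, ha k]
          · simp [ha k]
        have h2 : {n | n ∉ T ∧ a n = z} = insert k {n | n ∉ insert k T ∧ a n = z} := by
          ext n
          by_cases hn : n = k
          · simp [hn, hk, hzk]
          · simp [hn]
        rw [h1, h2, Set.encard_insert_of_notMem (by simp), add_comm] at ho
        exact ENat.add_left_injective_of_ne_top ENat.one_ne_top ho
      · have h1 : analyticOrderAt (fun z => 1 - z / a k) z = 0 := by
          rw [hlin.analyticOrderAt_eq_zero, sub_ne_zero]
          intro h
          have := ha k
          field_simp at h
          exact hzk h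
        have h2 : {n | n ∉ T ∧ a n = z} = {n | n ∉ insert k T ∧ a n = z} := by
          ext n
          by_cases hn : n = k
          · simp [hn, hzk]
          · simp [hn]
        rwa [h1, zero_add, h2] at ho

/-- A bound for the logarithmic derivative of a zero-free function, from Borel–Carathéodory. -/
theorem norm_logDeriv_le {G : ℂ → ℂ} {R A : ℝ} (hR : 0 < R) (hA : 0 < A)
    (hG : DifferentiableOn ℂ G (Metric.ball 0 (2 * R)))
    (h0 : ∀ z ∈ Metric.ball (0 : ℂ) (2 * R), G z ≠ 0)
    (hb : ∀ z ∈ Metric.ball (0 : ℂ) (2 * R), ‖G z‖ ≤ ‖G 0‖ * Real.exp A) {z : ℂ} (hz : ‖z‖ ≤ R) :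
    ‖logDeriv G z‖ ≤ 12 * A / R := by
  have hmem0 : (0 : ℂ) ∈ Metric.ball (0 : ℂ) (2 * R) := by simp [hR]
  have hlog : DifferentiableOn ℂ (logDeriv G) (Metric.ball 0 (2 * R)) :=
    (hG.deriv Metric.isOpen_ball).div hG h0
  obtain ⟨h, hh0, hh⟩ := hlog.isExactOn_ball.with_val_at 0 0
  have hhd : DifferentiableOn ℂ h (Metric.ball 0 (2 * R)) := fun z hz =>
    (hh z hz).differentiableAt.differentiableWithinAt
  have hconst : ∀ z ∈ Metric.ball (0 : ℂ) (2 * R), G z * exp (-h z) = G 0 := by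
    intro z hz
    have := Metric.isOpen_ball.is_const_of_deriv_eq_zero (convex_ball _ _).isPreconnected
      (f := fun z => G z * exp (-h z)) (hG.mul hhd.neg.cexp) (fun w hw => ?_) hz hmem0
    · simpa [hh0] using this
    · have h1 := (hG.differentiableAt (Metric.isOpen_ball.mem_nhds hw)).hasDerivAt
      have h2 := (h1.mul (hh w hw).neg.cexp).deriv
      refine h2.trans ?_
      have := h0 w hw
      simp only [logDeriv_apply, Pi.zero_apply]
      field_simp
      ring
  have hre : Set.MapsTo h (Metric.ball 0 (2 * R)) {z | z.re ≤ A} := by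
    intro z hz
    have h1 := hb z hz
    have h3 : 0 < ‖G z‖ := norm_pos_iff.2 (h0 z hz)
    rw [← hconst z hz, norm_mul, norm_exp, mul_assoc, ← Real.exp_add] at h1
    have h2 : 1 ≤ Real.exp ((-h z).re + A) := by
      by_contra! hc
      nlinarith
    rw [Real.one_le_exp_iff] at h2
    simp only [neg_re] at h2
    simp only [Set.mem_ofPred_eq]
    linarith
  -- Borel–Carathéodory with outer radius `2R` gives `2A |w| / (2R - |w|)`, at most `6A` for `|w| ≤
  -- 3R/2`. Cauchy's estimate on a circle of radius `R/2` around `z` then gives `12A / R`.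
  have hbd : ∀ w : ℂ, ‖w‖ ≤ 3 / 2 * R → ‖h w‖ ≤ 6 * A := by
    intro w hw
    have h1 := borelCaratheodory_zero hA hhd hre (by positivity)
      (show w ∈ Metric.ball 0 (2 * R) by rw [mem_ball_zero_iff]; linarith) hh0
    refine h1.trans ?_
    rw [div_le_iff₀ (by linarith)]
    nlinarith
  have hzm : z ∈ Metric.ball (0 : ℂ) (2 * R) := by rw [mem_ball_zero_iff]; linarith
  rw [← (hh z hzm).deriv]
  have h2 := norm_deriv_le_of_forall_mem_sphere_norm_le (c := z) (R := R / 2) (C := 6 * A) (f := h)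
    (by positivity) ?_ fun w hw => hbd w ?_
  · refine h2.trans (le_of_eq ?_)
    field_simp
    norm_num
  · refine DifferentiableOn.diffContOnCl (hhd.mono fun w hw => ?_)
    rw [closure_ball _ (by positivity), Metric.mem_closedBall, dist_eq_norm] at hw
    rw [mem_ball_zero_iff]
    have := norm_sub_norm_le w z
    linarith
  · rw [mem_sphere_iff_norm] at hw
    have := norm_sub_norm_le w z
    linarith

theorem exists_norm_le_mul_exp {F : ℂ → ℂ} (hF : Continuous F) {q : ℝ}
    (h : F =O[Bornology.cobounded ℂ] fun z => Real.exp (‖z‖ ^ q)) :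
    ∃ K : ℝ, 0 < K ∧ ∀ z, ‖F z‖ ≤ K * Real.exp (‖z‖ ^ q) := by
  obtain ⟨C, hC⟩ := h.bound
  rw [← comap_norm_atTop, (atTop_basis.comap _).eventually_iff] at hC
  obtain ⟨r, -, hr⟩ := hC
  obtain ⟨B, hB⟩ := (isCompact_closedBall (0 : ℂ) r).exists_bound_of_continuousOn hF.continuousOn
  refine ⟨max (max B C) 1, by positivity, fun z => ?_⟩
  have h1 : 1 ≤ Real.exp (‖z‖ ^ q) := Real.one_le_exp (by positivity)
  rcases le_total r ‖z‖ with hz | hz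
  · refine (hr (Set.mem_preimage.2 hz)).trans ?_
    rw [Real.norm_of_nonneg (Real.exp_pos _).le]
    gcongr
    exact (le_max_right B C).trans (le_max_left _ _)
  · have h2 := hB z (by simpa using hz)
    have h3 : B ≤ max (max B C) 1 := (le_max_left B C).trans (le_max_left _ _)
    have h4 : 0 < max (max B C) 1 := by positivity
    nlinarith

variable {a : ℕ → ℂ} {α Ψ ε : ℝ} {F : ℂ → ℂ}

theorem IsZetaSequence.exists_finset (ha : IsZetaSequence a α Ψ ε) (R : ℝ) :
    ∃ T : Finset ℕ, ∀ n, n ∈ T ↔ ‖a n‖ ≤ R := by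
  obtain ⟨n₀, hn₀⟩ := (ha.norm_tendsto.eventually_gt_atTop R).exists_forall_of_atTop
  refine ⟨(Finset.range n₀).filter fun n => ‖a n‖ ≤ R, fun n => ?_⟩
  rw [Finset.mem_filter, Finset.mem_range, and_iff_right_iff_imp]
  intro h
  by_contra! hn
  exact absurd (hn₀ n hn) (not_lt.2 h)

theorem IsCharacteristicFunction.ne_zero (hF : IsCharacteristicFunction a α F) {z : ℂ}
    (hz : ∀ n, a n ≠ z) : F z ≠ 0 := by
  have h := hF.zeros z
  rw [Set.encard_eq_zero.2 (by ext n; simpa using hz n)] at h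
  exact (hF.entire.analyticAt z).analyticOrderAt_eq_zero.1 h

/-- Splitting off only finitely many zeros, at a scale depending on `R`, replaces the Hadamard
factorization. Any exponent `q > α` suffices, since only large `Re s` is needed later. -/
theorem exists_logDeriv_eq (ha : IsZetaSequence a α Ψ ε) (hF : IsCharacteristicFunction a α F) :
    ∃ C q : ℝ, 0 < C ∧ 0 < q ∧ ∀ R : ℝ, 1 ≤ R → ∃ (T : Finset ℕ) (h : ℂ → ℂ),
      (∀ n, n ∈ T ↔ ‖a n‖ ≤ 2 * R) ∧ (T.card : ℝ) ≤ C * R ^ q ∧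
      DifferentiableOn ℂ h (Metric.ball 0 (2 * R)) ∧ (∀ z, ‖z‖ ≤ R → ‖h z‖ ≤ C * R ^ q) ∧
      ∀ z, ‖z‖ < 2 * R → F z ≠ 0 → logDeriv F z = ∑ n ∈ T, (z - a n)⁻¹ + h z := by
  obtain ⟨q, hq⟩ : ∃ q, q = max α 0 + 1 := ⟨_, rfl⟩
  have hq0 : 0 < q := by have := le_max_right α 0; linarith
  have hαq : α < q := by have := le_max_left α 0; linarith
  obtain ⟨K, hK0, hK⟩ := exists_norm_le_mul_exp hF.entire.continuous (hF.isBigO hαq)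
  have hF0 : F 0 ≠ 0 := hF.ne_zero ha.ne_zero
  have hF0' := norm_pos_iff.2 hF0
  set S := ∑' n, ‖a n‖ ^ (-q)
  have hS0 : 0 ≤ S := tsum_nonneg fun n => by positivity
  set B := |Real.log (K / ‖F 0‖)|
  have hB0 : 0 ≤ B := abs_nonneg _
  -- The first summand bounds the number of zeros, from `card T * (2R) ^ (-q) ≤ S`; the second comes
  -- from `norm_logDeriv_le` with `A = B + (4R) ^ q`.
  refine ⟨S * 2 ^ q + 12 * (B + 4 ^ q), q, by positivity, hq0, fun R hR => ?_⟩
  have hR0 : 0 < R := by linarith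
  have hRq : 1 ≤ R ^ q := Real.one_le_rpow hR hq0.le
  obtain ⟨T, hT⟩ := ha.exists_finset (2 * R)
  obtain ⟨G, hG, hFG, hGz⟩ := exists_eq_prod_mul ha.ne_zero hF.entire hF.zeros T
  have hGne : ∀ z ∈ Metric.ball (0 : ℂ) (2 * R), G z ≠ 0 := by
    intro z hz
    rw [mem_ball_zero_iff] at hz
    refine (hG.analyticAt z).analyticOrderAt_eq_zero.1 ?_
    rw [hGz, Set.encard_eq_zero, Set.eq_empty_iff_forall_notMem]
    rintro n ⟨hn, rfl⟩
    exact hn ((hT n).2 hz.le)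
  have hG0 : G 0 = F 0 := by simp [hFG]
  have hGle : ∀ z, ‖z‖ ≤ 4 * R → ‖G z‖ ≤ K * Real.exp ((4 * R) ^ q) := by
    intro z hz
    -- On `|w| = 4R` every factor satisfies `|1 - w / a n| ≥ 2 - 1`, because `|a n| ≤ 2R`. Hence
    -- `|G| ≤ |F|` there, and the maximum principle carries the bound inside.
    refine norm_le_of_forall_mem_frontier_norm_le (U := Metric.ball 0 (4 * R))
      Metric.isBounded_ball hG.diffContOnCl (fun w hw => ?_) ?_
    · rw [frontier_ball _ (by positivity), mem_sphere_zero_iff_norm] at hw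
      refine le_trans ?_ ((hK w).trans_eq (by rw [hw]))
      rw [hFG, norm_mul, norm_prod]
      refine le_mul_of_one_le_left (norm_nonneg _) (Finset.one_le_prod fun n hn => ?_)
      have h1 := (hT n).1 hn
      have h2 := ha.norm_pos n
      have h3 : 2 ≤ ‖w / a n‖ := by
        rw [norm_div, hw, le_div_iff₀ h2]; linarith
      have h4 := norm_sub_norm_le (w / a n) 1
      rw [norm_one, norm_sub_rev] at h4
      linarith
    · rw [closure_ball _ (by positivity)]; simpa using hz
  have hA : 0 < B + (4 * R) ^ q := by positivity
  refine ⟨T, logDeriv G, hT, ?_, ?_, ?_, ?_⟩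
  · have h1 : ∑ n ∈ T, ‖a n‖ ^ (-q) ≤ S :=
      (ha.summable_rpow hαq).sum_le_tsum _ fun n _ => by positivity
    have h2 : T.card • (2 * R) ^ (-q) ≤ ∑ n ∈ T, ‖a n‖ ^ (-q) :=
      Finset.card_nsmul_le_sum _ _ _ fun n hn =>
        Real.rpow_le_rpow_of_nonpos (ha.norm_pos n) ((hT n).1 hn) (by linarith)
    have h3 := h2.trans h1
    rw [nsmul_eq_mul, Real.rpow_neg (by positivity), ← div_eq_mul_inv,
      div_le_iff₀ (by positivity), Real.mul_rpow (by norm_num) hR0.le] at h3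
    have : 0 ≤ 12 * (B + 4 ^ q) * R ^ q := by positivity
    linarith
  · exact ((hG.differentiableOn.deriv Metric.isOpen_ball)).div hG.differentiableOn hGne
  · intro z hz
    have h1 := norm_logDeriv_le hR0 hA hG.differentiableOn hGne (fun w hw => ?_) hz
    · refine h1.trans ((div_le_self (by positivity) hR).trans ?_)
      rw [Real.mul_rpow (by norm_num) hR0.le]
      have : 0 ≤ S * 2 ^ q * R ^ q := by positivity
      nlinarith
    · rw [mem_ball_zero_iff] at hw
      refine (hGle w (by linarith)).trans ?_
      have h2 : K / ‖F 0‖ ≤ Real.exp B := by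
        rw [← Real.log_le_iff_le_exp (by positivity)]
        exact le_abs_self _
      rw [div_le_iff₀ hF0'] at h2
      rw [hG0, Real.exp_add, ← mul_assoc, mul_comm ‖F 0‖]
      gcongr
  · intro z hz hFz
    have hp : ∏ n ∈ T, (1 - z / a n) ≠ 0 := fun h => hFz (by rw [hFG, h, zero_mul])
    rw [show F = fun z => (∏ n ∈ T, (1 - z / a n)) * G z from funext hFG,
      logDeriv_mul z hp (hGne z (by simpa using hz)) (by fun_prop) (hG z),
      logDeriv_prod (Finset.prod_ne_zero_iff.1 hp) (by fun_prop)]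
    congr 1
    refine Finset.sum_congr rfl fun n hn => ?_
    have h1 := Finset.prod_ne_zero_iff.1 hp n hn
    have h2 := ha.ne_zero n
    have h3 : z - a n ≠ 0 := by
      intro h
      rw [sub_eq_zero.1 h, div_self h2] at h1
      simp at h1
    have hd : HasDerivAt (fun z => 1 - z / a n) (-(1 / a n)) z :=
      ((hasDerivAt_id z).div_const _).const_sub 1
    rw [logDeriv_apply, hd.deriv]
    have h4 : a n - z ≠ 0 := fun h => h3 (by linear_combination -h)
    field_simp
    ring

end ZetaSeq

/-! ### The limit of the keyhole integrals is the zeta function. -/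

namespace ZetaSeq

open Filter Topology Complex

theorem integral_mul_comp_sum_add {ι : Type*} {T : Finset ι} {f : ι → ℂ → ℂ} {g h : ℂ → ℂ}
    {k γ : ℝ → ℂ} {p q : ℝ} (hk : ContinuousOn k (Set.uIcc p q))
    (hf : ∀ n ∈ T, ContinuousOn (fun x => f n (γ x)) (Set.uIcc p q))
    (hh : ContinuousOn (fun x => h (γ x)) (Set.uIcc p q))
    (hg : ∀ x ∈ Set.uIcc p q, g (γ x) = ∑ n ∈ T, f n (γ x) + h (γ x)) :
    ∫ x in p..q, k x * g (γ x) =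
      ∑ n ∈ T, (∫ x in p..q, k x * f n (γ x)) + ∫ x in p..q, k x * h (γ x) := by
  have hi : ∀ n ∈ T, IntervalIntegrable (fun x => k x * f n (γ x)) MeasureTheory.volume p q :=
    fun n hn => (hk.mul (hf n hn)).intervalIntegrable
  have hhi : IntervalIntegrable (fun x => k x * h (γ x)) MeasureTheory.volume p q :=
    (hk.mul hh).intervalIntegrable
  have hsi : IntervalIntegrable (fun x => ∑ n ∈ T, k x * f n (γ x)) MeasureTheory.volume p q :=
    ContinuousOn.intervalIntegrable (continuousOn_finsetSum T fun n hn => hk.mul (hf n hn))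
  rw [← intervalIntegral.integral_finsetSum hi, ← intervalIntegral.integral_add
    hsi hhi]
  refine intervalIntegral.integral_congr fun x hx => ?_
  simp only [hg x hx, mul_add, Finset.mul_sum]

theorem rayIntegral_sum_add {ι : Type*} {T : Finset ι} {f : ι → ℂ → ℂ} {g h : ℂ → ℂ}
    {Ψ x₀ X : ℝ} (s : ℂ)
    (hf : ∀ n ∈ T, ContinuousOn (fun x : ℝ => f n (exp (x + Ψ * I))) (Set.uIcc x₀ X))
    (hh : ContinuousOn (fun x : ℝ => h (exp (x + Ψ * I))) (Set.uIcc x₀ X))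
    (hg : ∀ x ∈ Set.uIcc x₀ X,
      g (exp (x + Ψ * I)) = ∑ n ∈ T, f n (exp (x + Ψ * I)) + h (exp (x + Ψ * I))) :
    rayIntegral Ψ x₀ X s g = ∑ n ∈ T, rayIntegral Ψ x₀ X s (f n) + rayIntegral Ψ x₀ X s h :=
  integral_mul_comp_sum_add (k := fun x : ℝ => exp ((1 - s) * (x + Ψ * I)))
    (γ := fun x : ℝ => exp (x + Ψ * I)) (by fun_prop) hf hh hg

theorem arcIntegral_sum_add {ι : Type*} {T : Finset ι} {f : ι → ℂ → ℂ} {g h : ℂ → ℂ}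
    {Ψ X : ℝ} (s : ℂ)
    (hf : ∀ n ∈ T, Continuous fun y : ℝ => f n (exp (X + y * I)))
    (hh : Continuous fun y : ℝ => h (exp (X + y * I)))
    (hg : ∀ y : ℝ, g (exp (X + y * I)) = ∑ n ∈ T, f n (exp (X + y * I)) + h (exp (X + y * I))) :
    arcIntegral Ψ X s g = ∑ n ∈ T, arcIntegral Ψ X s (f n) + arcIntegral Ψ X s h := by
  simp only [arcIntegral]
  rw [← Finset.mul_sum, ← mul_add]
  congr 1
  exact integral_mul_comp_sum_add (k := fun y : ℝ => exp ((1 - s) * (X + y * I)))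
    (γ := fun y : ℝ => exp (X + y * I)) (by fun_prop) (fun n hn => (hf n hn).continuousOn)
    hh.continuousOn fun y _ => hg y

variable {a : ℕ → ℂ} {α Ψ ε : ℝ} {F : ℂ → ℂ}

theorem IsZetaSequence.exp_ne (ha : IsZetaSequence a α Ψ ε) (n : ℕ) (x : ℝ) :
    exp (x + Ψ * I) ≠ a n :=
  fun h => ha.notMem_sector n (h ▸ exp_mem_sector Ψ x ha.eps_pos)

theorem IsZetaSequence.exp_ne_of_lt (ha : IsZetaSequence a α Ψ ε) {x₀ : ℝ}
    (hx₀ : Real.exp x₀ < ‖a 0‖) (n : ℕ) (y : ℝ) : exp (x₀ + y * I) ≠ a n := by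
  intro h
  have h1 := congrArg norm h
  have h2 := ha.norm_monotone n.zero_le
  simp only [norm_exp] at h1 h2
  simp at h1
  linarith

/-- The keyhole functional applied to `1 / (z - a n)` is close to `2πi a n ^ (-s)`. -/
theorem IsZetaSequence.exists_norm_keyhole_sub_le (ha : IsZetaSequence a α Ψ ε) {x₀ : ℝ}
    (hx₀ : Real.exp x₀ < ‖a 0‖) {s : ℂ} (hs : 0 ≤ s.re) :
    ∃ D : ℝ, 0 ≤ D ∧ ∀ (n : ℕ) (X : ℝ), ‖a n‖ ≤ 2 * Real.exp X →
      ‖(exp (2 * Real.pi * I * s) - 1) * rayIntegral Ψ x₀ X s (fun z => (z - a n)⁻¹)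
        - arcIntegral Ψ x₀ s (fun z => (z - a n)⁻¹) - 2 * Real.pi * I * cutPowNeg Ψ (a n) s‖
      ≤ D * Real.exp X ^ (-s.re) := by
  obtain ⟨c, hc, hcone⟩ := exists_cone_subset_sector Ψ ha.eps_pos
  set M := Real.exp (3 * Real.pi * |s.im|)
  have hp := Real.pi_pos
  have hl4 : 0 < Real.log 4 := Real.log_pos (by norm_num)
  refine ⟨2 * Real.pi * M * 2 + ‖exp (2 * Real.pi * I * s) - 1‖ * (c⁻¹ * M * Real.log 4),
    by positivity, fun n X hn => ?_⟩
  -- The point `a n` may lie on or near the circle of radius `e^X`, or outside it. Extending the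
  -- keyhole to radius `4 e^X` encloses it at distance at least `2 e^X` from the arc; the extra
  -- piece of ray, of logarithmic length `log 4`, is controlled by the cone estimate.
  set Y := X + Real.log 4
  have hY : Real.exp Y = 4 * Real.exp X := by
    rw [Real.exp_add, Real.exp_log (by norm_num), mul_comm]
  have hXpos := Real.exp_pos X
  set l := argLog (Ψ - Real.pi) (a n)
  have hl : exp l = a n := exp_argLog _ (ha.ne_zero n)
  have hlre : l.re = Real.log ‖a n‖ := argLog_re _ _
  have h1 : x₀ < l.re := by
    rw [hlre, Real.lt_log_iff_exp_lt (ha.norm_pos n)]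
    exact hx₀.trans_le (ha.norm_monotone n.zero_le)
  have h2 : l.re < Y := by
    rw [hlre, Real.log_lt_iff_lt_exp (ha.norm_pos n), hY]
    linarith
  have hkey := keyhole_inv_sub s h1 h2
    (argLog_im_mem_Ioo ha.eps_pos (ha.ne_zero n) (ha.notMem_sector n))
  rw [hl] at hkey
  have hcont : Continuous fun x : ℝ =>
      exp ((1 - s) * (x + Ψ * I)) * (exp (x + Ψ * I) - a n)⁻¹ :=
    Continuous.mul (by fun_prop)
      (Continuous.inv₀ (by fun_prop) fun x => sub_ne_zero.2 (ha.exp_ne n x))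
  have hadd : rayIntegral Ψ x₀ Y s (fun z => (z - a n)⁻¹)
      = rayIntegral Ψ x₀ X s (fun z => (z - a n)⁻¹) + rayIntegral Ψ X Y s (fun z => (z - a n)⁻¹) :=
    (intervalIntegral.integral_add_adjacent_intervals (hcont.intervalIntegrable _ _)
      (hcont.intervalIntegrable _ _)).symm
  have harc : ‖arcIntegral Ψ Y s (fun z => (z - a n)⁻¹)‖
      ≤ 2 * Real.pi * M * (2 * Real.exp X ^ (-s.re)) := by
    refine (norm_arcIntegral_le ha.angle_mem Y s (B := (2 * Real.exp X)⁻¹) fun z hz => ?_).trans ?_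
    · rw [norm_inv]
      have := norm_sub_norm_le z (a n)
      gcongr
      linarith
    · have h3 : Real.exp Y ^ (1 - s.re) = Real.exp Y ^ (-s.re) * (4 * Real.exp X) := by
        rw [show 1 - s.re = -s.re + 1 by ring, Real.rpow_add (Real.exp_pos _), Real.rpow_one, hY]
      have h4 : Real.exp Y ^ (-s.re) ≤ Real.exp X ^ (-s.re) :=
        Real.rpow_le_rpow_of_nonpos hXpos (by rw [hY]; linarith) (by linarith)
      rw [h3]
      refine mul_le_mul_of_nonneg_left ?_ (by positivity)
      rw [mul_inv]
      field_simp
      linarith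
  have hray : ‖rayIntegral Ψ X Y s (fun z => (z - a n)⁻¹)‖
      ≤ c⁻¹ * M * Real.exp X ^ (-s.re) * Real.log 4 := by
    refine (norm_rayIntegral_le ha.angle_mem (D := c⁻¹) (by linarith) hs fun x => ?_).trans_eq ?_
    · rw [norm_inv, Real.exp_neg, ← mul_inv]
      have := Real.exp_pos x
      refine inv_anti₀ (by positivity) ?_
      by_contra! hlt
      refine ha.notMem_sector n (hcone (Real.exp x) this (a n) ?_)
      rwa [norm_sub_rev, ofReal_exp, ← exp_add]
    · rw [show Y - X = Real.log 4 by ring]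
  have e : (exp (2 * Real.pi * I * s) - 1) * rayIntegral Ψ x₀ X s (fun z => (z - a n)⁻¹)
        - arcIntegral Ψ x₀ s (fun z => (z - a n)⁻¹) - 2 * Real.pi * I * cutPowNeg Ψ (a n) s
      = -arcIntegral Ψ Y s (fun z => (z - a n)⁻¹)
        - (exp (2 * Real.pi * I * s) - 1) * rayIntegral Ψ X Y s (fun z => (z - a n)⁻¹) := by
    rw [hadd] at hkey
    rw [cutPowNeg]
    linear_combination hkey
  rw [e]
  refine (norm_sub_le _ _).trans ?_
  rw [norm_neg, norm_mul]
  have := mul_le_mul_of_nonneg_left hray (norm_nonneg (exp (2 * Real.pi * I * s) - 1))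
  calc _ ≤ _ := add_le_add harc this
    _ = _ := by ring

/-- With `R = e^X`, there are `O(R ^ q)` poles with error `O(R ^ (-Re s))` each, and the zero-free
part leaves an arc integral `O(R ^ (q + 1 - Re s))`. All of this vanishes in the limit when `Re s >
q + 1`. -/
theorem exists_tendsto_keyhole (ha : IsZetaSequence a α Ψ ε) (hF : IsCharacteristicFunction a α F)
    {x₀ : ℝ} (hx₀ : Real.exp x₀ < ‖a 0‖) :
    ∃ S : ℝ, ∀ s : ℂ, S < s.re → Tendsto (fun X : ℝ =>
      (exp (2 * Real.pi * I * s) - 1) * rayIntegral Ψ x₀ X s (logDeriv F)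
        - arcIntegral Ψ x₀ s (logDeriv F)) atTop
      (𝓝 (2 * Real.pi * I * ∑' n, cutPowNeg Ψ (a n) s)) := by
  obtain ⟨C, q, hC, hq, hdec⟩ := exists_logDeriv_eq ha hF
  refine ⟨max α (q + 1), fun s hs => ?_⟩
  have hsα : α < s.re := (le_max_left _ _).trans_lt hs
  have hsq : q + 1 < s.re := (le_max_right _ _).trans_lt hs
  obtain ⟨D, hD, hpole⟩ := ha.exists_norm_keyhole_sub_le hx₀ (s := s) (by linarith)
  choose T hT using fun X : ℝ => ha.exists_finset (2 * Real.exp X)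
  have hTlim : Tendsto T atTop atTop := by
    refine tendsto_atTop_finset_of_monotone (fun X Y h n hn => ?_) fun n => ?_
    · rw [hT] at *
      exact hn.trans (by gcongr)
    · obtain ⟨X, hX⟩ := (Real.tendsto_exp_atTop.eventually_ge_atTop ‖a n‖).exists
      exact ⟨X, (hT X n).2 (by have := Real.exp_pos X; linarith)⟩
  have hmain : Tendsto (fun X => 2 * Real.pi * I * ∑ n ∈ T X, cutPowNeg Ψ (a n) s) atTop
      (𝓝 (2 * Real.pi * I * ∑' n, cutPowNeg Ψ (a n) s)) :=
    ((ha.summable_cutPowNeg hsα).hasSum.comp hTlim).const_mul _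
  set M := Real.exp (3 * Real.pi * |s.im|)
  have hp := Real.pi_pos
  set E := C * D + 2 * Real.pi * M * C
  have hbound : ∀ X : ℝ, 0 ≤ X → x₀ ≤ X →
      ‖((exp (2 * Real.pi * I * s) - 1) * rayIntegral Ψ x₀ X s (logDeriv F)
        - arcIntegral Ψ x₀ s (logDeriv F)) - 2 * Real.pi * I * ∑ n ∈ T X, cutPowNeg Ψ (a n) s‖
      ≤ E * Real.exp ((q + 1 - s.re) * X) := by
    intro X hX hxX
    have hR : 1 ≤ Real.exp X := Real.one_le_exp hX
    obtain ⟨T', h, hT', hcard, hh, hhb, hlog⟩ := hdec (Real.exp X) hR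
    obtain rfl : T' = T X := by ext n; rw [hT', hT]
    have hray : rayIntegral Ψ x₀ X s (logDeriv F) =
        ∑ n ∈ T X, rayIntegral Ψ x₀ X s (fun z => (z - a n)⁻¹) + rayIntegral Ψ x₀ X s h := by
      have hn : ∀ x ∈ Set.uIcc x₀ X, ‖exp (x + Ψ * I)‖ < 2 * Real.exp X := by
        intro x hx
        rw [Set.uIcc_of_le hxX] at hx
        rw [norm_exp]
        have := Real.exp_le_exp.2 hx.2
        simp
        linarith
      refine rayIntegral_sum_add (f := fun n z => (z - a n)⁻¹) s (fun n _ => ?_) ?_ fun x hx => ?_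
      · exact ContinuousOn.inv₀ (by fun_prop) fun x _ => sub_ne_zero.2 (ha.exp_ne n x)
      · exact hh.continuousOn.comp (by fun_prop) fun x hx => by simpa using hn x hx
      · exact hlog _ (hn x hx) (hF.ne_zero fun n => (ha.exp_ne n x).symm)
    have harc : arcIntegral Ψ x₀ s (logDeriv F) =
        ∑ n ∈ T X, arcIntegral Ψ x₀ s (fun z => (z - a n)⁻¹) + arcIntegral Ψ x₀ s h := by
      have hn : ∀ y : ℝ, ‖exp (x₀ + y * I)‖ < 2 * Real.exp X := by
        intro y
        rw [norm_exp]
        have := Real.exp_le_exp.2 hxX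
        simp
        linarith
      refine arcIntegral_sum_add (f := fun n z => (z - a n)⁻¹) s (fun n _ => ?_) ?_ fun y => ?_
      · exact Continuous.inv₀ (by fun_prop) fun y => sub_ne_zero.2 (ha.exp_ne_of_lt hx₀ n y)
      · exact hh.continuousOn.comp_continuous (by fun_prop) fun y => by simpa using hn y
      · exact hlog _ (hn y) (hF.ne_zero fun n => (ha.exp_ne_of_lt hx₀ n y).symm)
    have hhol := keyhole_of_differentiableOn (Ψ := Ψ) hxX (show Real.exp X < 2 * Real.exp X by linarith) s hh
    have e : ((exp (2 * Real.pi * I * s) - 1) * rayIntegral Ψ x₀ X s (logDeriv F)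
        - arcIntegral Ψ x₀ s (logDeriv F)) - 2 * Real.pi * I * ∑ n ∈ T X, cutPowNeg Ψ (a n) s
        = ∑ n ∈ T X, ((exp (2 * Real.pi * I * s) - 1) *
            rayIntegral Ψ x₀ X s (fun z => (z - a n)⁻¹)
          - arcIntegral Ψ x₀ s (fun z => (z - a n)⁻¹) - 2 * Real.pi * I * cutPowNeg Ψ (a n) s)
          - arcIntegral Ψ X s h := by
      rw [hray, harc, Finset.sum_sub_distrib, Finset.sum_sub_distrib, ← Finset.mul_sum,
        ← Finset.mul_sum]
      linear_combination hhol
    have hsplit : ∀ t : ℝ, Real.exp X ^ t = Real.exp (t * X) := fun t => by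
      rw [← Real.exp_mul, mul_comm]
    have b1 := norm_sum_le_of_le (T X) fun n hn => hpole n X ((hT X n).1 hn)
    rw [Finset.sum_const, nsmul_eq_mul] at b1
    have b2 := norm_arcIntegral_le ha.angle_mem X s (f := h) (B := C * Real.exp X ^ q)
      fun z hz => hhb z hz.le
    rw [e]
    refine (norm_sub_le _ _).trans ((add_le_add b1 b2).trans ?_)
    have b3 : (T X).card * (D * Real.exp X ^ (-s.re))
        ≤ C * D * Real.exp ((q + 1 - s.re) * X) := by
      calc (T X).card * (D * Real.exp X ^ (-s.re))
          ≤ C * Real.exp X ^ q * (D * Real.exp X ^ (-s.re)) := by gcongr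
        _ = C * D * Real.exp ((q - s.re) * X) := by
          rw [hsplit, hsplit, show (q - s.re) * X = q * X + -s.re * X by ring, Real.exp_add]
          ring
        _ ≤ _ := by
          refine mul_le_mul_of_nonneg_left (Real.exp_le_exp.2 ?_) (by positivity)
          nlinarith
    have b4 : Real.exp X ^ (1 - s.re) * (C * Real.exp X ^ q)
        = C * Real.exp ((q + 1 - s.re) * X) := by
      rw [hsplit, hsplit, show (q + 1 - s.re) * X = q * X + (1 - s.re) * X by ring, Real.exp_add]
      ring
    rw [b4]
    refine (add_le_add_left b3 _).trans_eq ?_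
    simp only [E, M]
    ring
  have hzero : Tendsto (fun X : ℝ => E * Real.exp ((q + 1 - s.re) * X)) atTop (𝓝 0) := by
    rw [← mul_zero E]
    refine (Real.tendsto_exp_atBot.comp ?_).const_mul E
    exact tendsto_id.const_mul_atTop_of_neg (by linarith)
  have herr := squeeze_zero_norm' (f := fun X : ℝ =>
    ((exp (2 * Real.pi * I * s) - 1) * rayIntegral Ψ x₀ X s (logDeriv F)
        - arcIntegral Ψ x₀ s (logDeriv F)) - 2 * Real.pi * I * ∑ n ∈ T X, cutPowNeg Ψ (a n) s)
    (by filter_upwards [eventually_ge_atTop 0, eventually_ge_atTop x₀] with X h1 h2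
        using hbound X h1 h2) hzero
  simpa using herr.add hmain

end ZetaSeq

/-! ### Laplace-type integrals along the ray. -/

namespace ZetaSeq

open Filter Topology Complex MeasureTheory

theorem differentiable_intervalIntegral_cexp {g φ : ℝ → ℂ} (hg : Continuous g)
    (hφ : Continuous φ) (p q : ℝ) :
    Differentiable ℂ fun s : ℂ => ∫ t in p..q, exp (s * g t) * φ t := by
  intro s₀
  obtain ⟨A, hA⟩ := isCompact_uIcc.exists_bound_of_continuousOn (s := Set.uIcc p q) hg.continuousOn
  obtain ⟨B, hB⟩ := isCompact_uIcc.exists_bound_of_continuousOn (s := Set.uIcc p q) hφ.continuousOn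
  refine (intervalIntegral.hasDerivAt_integral_of_dominated_loc_of_deriv_le
    (F' := fun s t => exp (s * g t) * g t * φ t)
    (bound := fun _ => Real.exp ((‖s₀‖ + 1) * A) * A * B) (Metric.ball_mem_nhds s₀ one_pos)
    (Eventually.of_forall fun s => ?_) ?_ ?_ ?_ ?_ ?_).2.differentiableAt
  · exact Continuous.aestronglyMeasurable (by fun_prop)
  · exact Continuous.intervalIntegrable (by fun_prop) _ _
  · exact Continuous.aestronglyMeasurable (by fun_prop)
  · refine Eventually.of_forall fun t ht s hs => ?_
    have h1 := hA t (Set.uIoc_subset_uIcc ht)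
    have h2 := hB t (Set.uIoc_subset_uIcc ht)
    have hA0 := (norm_nonneg _).trans h1
    have hs' : ‖s‖ ≤ ‖s₀‖ + 1 := by
      rw [Metric.mem_ball, dist_eq_norm] at hs
      have := norm_sub_norm_le s s₀
      linarith
    rw [norm_mul, norm_mul]
    gcongr
    refine (norm_exp_le_exp_norm _).trans (Real.exp_le_exp.2 ?_)
    rw [norm_mul]
    gcongr
  · exact intervalIntegrable_const
  · refine Eventually.of_forall fun t _ s _ => ?_
    exact ((hasDerivAt_mul_const (g t)).cexp).mul_const _

theorem differentiable_arcIntegral (Ψ X : ℝ) {f : ℂ → ℂ}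
    (hf : Continuous fun y : ℝ => f (exp (X + y * I))) :
    Differentiable ℂ fun s => arcIntegral Ψ X s f := by
  have h := differentiable_intervalIntegral_cexp (g := fun y : ℝ => -(X + y * I))
    (φ := fun y : ℝ => exp (X + y * I) * f (exp (X + y * I))) (by fun_prop)
    (Continuous.mul (by fun_prop) hf)
    (Ψ - 2 * Real.pi) Ψ
  convert! h.const_mul I using 1
  funext s
  rw [arcIntegral]
  congr 1
  refine intervalIntegral.integral_congr fun y _ => ?_
  rw [← mul_assoc, ← exp_add]
  ring_nf

theorem norm_exp_neg_mul_ray (Ψ x : ℝ) (s : ℂ) :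
    ‖exp (-s * (x + Ψ * I))‖ = Real.exp (s.im * Ψ) * Real.exp (-s.re * x) := by
  rw [norm_exp, ← Real.exp_add]
  congr 1
  simp
  ring

theorem integrableOn_exp_mul_of_norm_le {r : ℝ → ℂ} (hr : Continuous r) {C c x₀ : ℝ} (Ψ : ℝ)
    (hb : ∀ x, x₀ < x → ‖r x‖ ≤ C * Real.exp (c * x)) {s : ℂ} (hs : c < s.re) :
    IntegrableOn (fun x : ℝ => exp (-s * (x + Ψ * I)) * r x) (Set.Ioi x₀) := by
  have h1 : IntegrableOn (fun x => Real.exp (s.im * Ψ) * C * Real.exp ((c - s.re) * x))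
      (Set.Ioi x₀) := (integrableOn_exp_mul_Ioi (by linarith) x₀).const_mul _
  refine Integrable.mono' h1 (Continuous.aestronglyMeasurable (by fun_prop)) ?_
  refine (ae_restrict_iff' measurableSet_Ioi).2 (Eventually.of_forall fun x hx => ?_)
  rw [norm_mul, norm_exp_neg_mul_ray]
  calc _ ≤ Real.exp (s.im * Ψ) * Real.exp (-s.re * x) * (C * Real.exp (c * x)) := by
        gcongr; exact hb x hx
    _ = Real.exp (s.im * Ψ) * C * (Real.exp (-s.re * x) * Real.exp (c * x)) := by ring
    _ = _ := by rw [← Real.exp_add]; ring_nf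

theorem differentiableOn_integral_Ioi {r : ℝ → ℂ} (hr : Continuous r) {C c x₀ : ℝ} (Ψ : ℝ)
    (hb : ∀ x, x₀ < x → ‖r x‖ ≤ C * Real.exp (c * x)) :
    DifferentiableOn ℂ (fun s : ℂ => ∫ x : ℝ in Set.Ioi x₀, exp (-s * (x + Ψ * I)) * r x)
      {s | c < s.re} := by
  intro s₀ hs₀
  have hC : 0 ≤ C := by
    have := (norm_nonneg _).trans (hb (x₀ + 1) (by linarith))
    exact nonneg_of_mul_nonneg_left this (Real.exp_pos _)
  -- The gap is cut into quarters: on the ball of radius `η` one has `Re s ≥ c + 3η`, the factor `x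
  -- + iΨ` produced by differentiation costs `e^{η (x - x₀)}`, and a decay `e^{-2ηx}` remains.
  obtain ⟨η, hη⟩ : ∃ η, η = (s₀.re - c) / 4 := ⟨_, rfl⟩
  have hη0 : 0 < η := by simp only [Set.mem_ofPred_eq] at hs₀; linarith
  set w₀ : ℂ := x₀ + Ψ * I
  set K := Real.exp ((‖s₀‖ + η) * ‖w₀‖)
  set L := max η⁻¹ ‖w₀‖ + 1
  refine DifferentiableAt.differentiableWithinAt ?_
  refine (hasDerivAt_integral_of_dominated_loc_of_deriv_le
    (F' := fun (s : ℂ) (x : ℝ) => exp (-s * (x + Ψ * I)) * (-(x + Ψ * I)) * r x)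
    (bound := fun x => K * (L * Real.exp (η * (x - x₀))) *
      Real.exp (-(c + 3 * η) * (x - x₀)) * (C * Real.exp (c * x)))
    (Metric.ball_mem_nhds s₀ hη0)
    (Eventually.of_forall fun s => ?_) ?_ ?_ ?_ ?_ ?_).2.differentiableAt
  · exact Continuous.aestronglyMeasurable (by fun_prop)
  · exact integrableOn_exp_mul_of_norm_le hr Ψ hb hs₀
  · exact Continuous.aestronglyMeasurable (by fun_prop)
  · refine (ae_restrict_iff' measurableSet_Ioi).2 (Eventually.of_forall fun x hx s hs => ?_)
    rw [Metric.mem_ball, dist_eq_norm] at hs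
    have hx' : 0 < x - x₀ := sub_pos.2 hx
    have hre : c + 3 * η ≤ s.re := by
      have h1 := (abs_re_le_norm (s - s₀)).trans hs.le
      rw [sub_re, abs_le] at h1
      linarith [h1.1]
    have hnorm : ‖s‖ ≤ ‖s₀‖ + η := by
      have := norm_sub_norm_le s s₀
      linarith
    have e1 : (x : ℂ) + Ψ * I = w₀ + (x - x₀ : ℝ) := by simp only [w₀]; push_cast; ring
    rw [norm_mul, norm_mul, norm_neg, e1]
    have b1 : ‖exp (-s * (w₀ + (x - x₀ : ℝ)))‖ ≤ K * Real.exp (-(c + 3 * η) * (x - x₀)) := by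
      rw [mul_add, exp_add, norm_mul]
      have h2 : ‖exp (-s * w₀)‖ ≤ K := by
        refine (norm_exp_le_exp_norm _).trans (Real.exp_le_exp.2 ?_)
        rw [norm_mul, norm_neg]
        gcongr
      have h3 : ‖exp (-s * (x - x₀ : ℝ))‖ ≤ Real.exp (-(c + 3 * η) * (x - x₀)) := by
        rw [norm_exp, re_mul_ofReal, neg_re, Real.exp_le_exp]
        nlinarith
      exact mul_le_mul h2 h3 (norm_nonneg _) (Real.exp_pos _).le
    have b2 : ‖w₀ + (x - x₀ : ℝ)‖ ≤ L * Real.exp (η * (x - x₀)) := by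
      refine (norm_add_le _ _).trans ?_
      rw [norm_real, Real.norm_of_nonneg hx'.le]
      have h4 := Real.add_one_le_exp (η * (x - x₀))
      have h5 : ‖w₀‖ ≤ L := le_add_of_le_of_nonneg (le_max_right _ _) zero_le_one
      have h6 : η⁻¹ ≤ L := le_add_of_le_of_nonneg (le_max_left _ _) zero_le_one
      have h7 : η⁻¹ * (η * (x - x₀)) = x - x₀ := by field_simp
      have h8 : 0 ≤ η * (x - x₀) := by positivity
      have h9 : 0 ≤ L := (norm_nonneg _).trans h5
      nlinarith
    calc _ ≤ K * Real.exp (-(c + 3 * η) * (x - x₀)) * (L * Real.exp (η * (x - x₀))) *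
          (C * Real.exp (c * x)) := by
          gcongr
          exact hb x hx
      _ = _ := by ring
  · have h1 : IntegrableOn (fun x => K * L * C * Real.exp ((c + 2 * η) * x₀) *
        Real.exp (-(2 * η) * x)) (Set.Ioi x₀) :=
      (integrableOn_exp_mul_Ioi (by linarith) x₀).const_mul _
    refine h1.congr_fun (fun x _ => ?_) measurableSet_Ioi
    have : Real.exp ((c + 2 * η) * x₀) * Real.exp (-(2 * η) * x)
        = Real.exp (η * (x - x₀)) * Real.exp (-(c + 3 * η) * (x - x₀)) * Real.exp (c * x) := by
      rw [← Real.exp_add, ← Real.exp_add, ← Real.exp_add]; ring_nf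
    simp only []
    linear_combination K * L * C * this
  · refine Eventually.of_forall fun x s _ => ?_
    have h1 : HasDerivAt (fun s : ℂ => -s * (x + Ψ * I)) (-(x + Ψ * I)) s := by
      simpa using (hasDerivAt_id s).neg.mul_const ((x : ℂ) + Ψ * I)
    exact h1.cexp.mul_const _

/-- `-e^{-λw} * laplacePoly k λ w` is an antiderivative of `e^{-λw} w ^ k`. -/
noncomputable def laplacePoly : ℕ → ℂ → ℂ → ℂ
  | 0, l, _ => l⁻¹
  | k + 1, l, w => (w ^ (k + 1) + (k + 1) * laplacePoly k l w) / l

/-- The equation `l P - P' = w ^ k` is exactly what makes `-e^{-lw} P` an antiderivative of `e^{-lw}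
w ^ k`; it follows by induction from the recursion. -/
theorem exists_hasDerivAt_laplacePoly {l : ℂ} (hl : l ≠ 0) (k : ℕ) (w : ℂ) :
    ∃ D, HasDerivAt (laplacePoly k l) D w ∧ l * laplacePoly k l w - D = w ^ k := by
  induction k with
  | zero => exact ⟨0, hasDerivAt_const _ _, by simp [laplacePoly, hl]⟩
  | succ k ih =>
    obtain ⟨D, hD, hE⟩ := ih
    refine ⟨(((k + 1 : ℕ) : ℂ) * w ^ k + (k + 1) * D) / l, ?_, ?_⟩
    · have h1 : HasDerivAt (fun w : ℂ => w ^ (k + 1)) (((k + 1 : ℕ) : ℂ) * w ^ k) w := by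
        simpa using hasDerivAt_pow (k + 1) w
      exact (h1.add (hD.const_mul ((k : ℂ) + 1))).div_const l
    · simp only [laplacePoly]
      push_cast
      rw [← hE]
      field_simp
      ring

theorem hasDerivAt_exp_mul_laplacePoly {l : ℂ} (hl : l ≠ 0) (k : ℕ) (w : ℂ) :
    HasDerivAt (fun w => -(exp (-l * w) * laplacePoly k l w)) (exp (-l * w) * w ^ k) w := by
  obtain ⟨D, hD, hE⟩ := exists_hasDerivAt_laplacePoly hl k w
  have h1 : HasDerivAt (fun w => -l * w) (-l) w := by
    simpa using (hasDerivAt_id w).const_mul (-l)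
  convert! (h1.cexp.mul hD).neg using 1
  rw [← hE]
  ring

theorem laplacePoly_zero_right (k : ℕ) (l : ℂ) :
    laplacePoly k l 0 = k.factorial / l ^ (k + 1) := by
  induction k with
  | zero => simp [laplacePoly]
  | succ k ih =>
    simp only [laplacePoly, ih, Nat.factorial_succ]
    push_cast
    rw [zero_pow (by omega), pow_succ l (k + 1), zero_add, mul_div_assoc', div_div]

/-- The integral of `e^{-λw} w ^ k` over the segment from `0` to `w₀`. -/
noncomputable def segmentIntegral (k : ℕ) (w₀ l : ℂ) : ℂ :=
  ∫ u : ℝ in (0 : ℝ)..1, exp (l * (-w₀ * u)) * ((w₀ * u) ^ k * w₀)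

theorem differentiable_segmentIntegral (k : ℕ) (w₀ : ℂ) :
    Differentiable ℂ (segmentIntegral k w₀) :=
  differentiable_intervalIntegral_cexp (g := fun u : ℝ => -w₀ * u)
    (φ := fun u : ℝ => (w₀ * u) ^ k * w₀) (by fun_prop) (by fun_prop) 0 1

/-- This isolates the singularity at `l = 0`: formally the integral from `w₀` to infinity is the
full Laplace integral `k! / l ^ (k + 1)` minus the integral over the segment from `0` to `w₀`, which
is entire in `l`. -/
theorem exp_mul_laplacePoly_eq {l : ℂ} (hl : l ≠ 0) (k : ℕ) (w₀ : ℂ) :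
    exp (-l * w₀) * laplacePoly k l w₀
      = k.factorial / l ^ (k + 1) - segmentIntegral k w₀ l := by
  have h : ∀ u : ℝ, HasDerivAt (fun u : ℝ => -(exp (-l * (w₀ * u)) * laplacePoly k l (w₀ * u)))
      (exp (l * (-w₀ * u)) * ((w₀ * u) ^ k * w₀)) u := by
    intro u
    have h1 : HasDerivAt (fun u : ℝ => w₀ * (u : ℂ)) w₀ u := by
      simpa using (hasDerivAt_id u).ofReal_comp.const_mul w₀
    convert! HasDerivAt.comp_of_eq u (hasDerivAt_exp_mul_laplacePoly hl k (w₀ * u)) h1 rfl using 1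
    ring_nf
  have h2 := intervalIntegral.integral_eq_sub_of_hasDerivAt (a := 0) (b := 1) (fun u _ => h u)
    (Continuous.intervalIntegrable (by fun_prop) _ _)
  rw [segmentIntegral, h2]
  simp [laplacePoly_zero_right]

theorem integral_exp_mul_pow {l : ℂ} (hl : l ≠ 0) (k : ℕ) (Ψ x₀ X : ℝ) :
    ∫ x : ℝ in x₀..X, exp (-l * (x + Ψ * I)) * (x + Ψ * I) ^ k =
      exp (-l * (x₀ + Ψ * I)) * laplacePoly k l (x₀ + Ψ * I) -
        exp (-l * (X + Ψ * I)) * laplacePoly k l (X + Ψ * I) := by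
  have h : ∀ x : ℝ, HasDerivAt
      (fun x : ℝ => -(exp (-l * (x + Ψ * I)) * laplacePoly k l (x + Ψ * I)))
      (exp (-l * (x + Ψ * I)) * (x + Ψ * I) ^ k) x := by
    intro x
    have h1 : HasDerivAt (fun x : ℝ => (x : ℂ) + Ψ * I) 1 x :=
      (hasDerivAt_id x).ofReal_comp.add_const _
    convert! HasDerivAt.comp_of_eq x (hasDerivAt_exp_mul_laplacePoly hl k (x + Ψ * I)) h1 rfl
      using 1
    ring
  rw [intervalIntegral.integral_eq_sub_of_hasDerivAt (fun x _ => h x)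
    (Continuous.intervalIntegrable (by fun_prop) _ _)]
  ring

theorem tendsto_exp_mul_ray_pow (Ψ : ℝ) {l : ℂ} (hl : 0 < l.re) (k : ℕ) :
    Tendsto (fun x : ℝ => exp (-l * (x + Ψ * I)) * ((x : ℂ) + Ψ * I) ^ k) atTop (𝓝 0) := by
  have h1 : Tendsto (fun x : ℝ => Real.exp (l.im * Ψ) * (1 + |Ψ|) ^ k *
      (x ^ (k : ℝ) * Real.exp (-l.re * x))) atTop (𝓝 0) := by
    simpa using (tendsto_rpow_mul_exp_neg_mul_atTop_nhds_zero k l.re hl).const_mul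
      (Real.exp (l.im * Ψ) * (1 + |Ψ|) ^ k)
  refine squeeze_zero_norm' ?_ h1
  filter_upwards [eventually_ge_atTop 1] with x hx
  rw [norm_mul, norm_pow, norm_exp_neg_mul_ray, Real.rpow_natCast]
  have h2 : ‖(x : ℂ) + Ψ * I‖ ≤ (1 + |Ψ|) * x := by
    refine (norm_add_le _ _).trans ?_
    have := abs_nonneg Ψ
    simp only [norm_mul, norm_real, norm_I, mul_one, Real.norm_eq_abs, abs_of_pos (by linarith : 0 < x)]
    nlinarith
  calc _ ≤ Real.exp (l.im * Ψ) * Real.exp (-l.re * x) * ((1 + |Ψ|) * x) ^ k := by gcongr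
    _ = _ := by rw [mul_pow]; ring

theorem tendsto_exp_mul_laplacePoly (Ψ : ℝ) {l : ℂ} (hl : 0 < l.re) (k : ℕ) :
    Tendsto (fun x : ℝ => exp (-l * (x + Ψ * I)) * laplacePoly k l ((x : ℂ) + Ψ * I))
      atTop (𝓝 0) := by
  induction k with
  | zero =>
    have := (tendsto_exp_mul_ray_pow Ψ hl 0).mul_const l⁻¹
    simpa [laplacePoly] using this
  | succ k ih =>
    have := ((tendsto_exp_mul_ray_pow Ψ hl (k + 1)).add (ih.const_mul ((k : ℂ) + 1))).div_const l
    simp only [mul_zero, add_zero, zero_div] at this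
    refine this.congr fun x => ?_
    simp only [laplacePoly]
    ring

end ZetaSeq

/-! ### Integration by parts and insertion of the expansion. -/

namespace ZetaSeq

open Filter Topology Complex MeasureTheory

theorem tendsto_exp_ray (Ψ : ℝ) {ε : ℝ} (hε : 0 < ε) :
    Tendsto (fun x : ℝ => exp (x + Ψ * I)) atTop (Bornology.cobounded ℂ ⊓ 𝓟 (sector Ψ ε)) := by
  refine tendsto_inf.2 ⟨?_, tendsto_principal.2 (Eventually.of_forall fun x =>
    exp_mem_sector Ψ x hε)⟩
  rw [← tendsto_norm_atTop_iff_cobounded]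
  refine Real.tendsto_exp_atTop.congr fun x => ?_
  simp [norm_exp]

theorem exists_norm_le_mul_exp_of_isBigO {r : ℝ → ℂ} (hr : Continuous r) {c : ℝ}
    (h : r =O[atTop] fun x => Real.exp (c * x)) (x₀ : ℝ) :
    ∃ C, ∀ x, x₀ < x → ‖r x‖ ≤ C * Real.exp (c * x) := by
  obtain ⟨K, hK⟩ := h.bound
  obtain ⟨x₁, hx₁⟩ := hK.exists_forall_of_atTop
  obtain ⟨B, hB⟩ := isCompact_Icc.exists_bound_of_continuousOn (s := Set.Icc x₀ x₁)
    (f := fun x => r x * Real.exp (-(c * x))) (by fun_prop)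
  refine ⟨max K B, fun x hx => ?_⟩
  rcases le_total x₁ x with h1 | h1
  · refine (hx₁ x h1).trans ?_
    rw [Real.norm_of_nonneg (Real.exp_pos _).le]
    gcongr
    exact le_max_left _ _
  · have h2 := hB x ⟨hx.le, h1⟩
    rw [norm_mul, norm_real, Real.norm_of_nonneg (Real.exp_pos _).le, Real.exp_neg,
      ← div_eq_mul_inv, div_le_iff₀ (Real.exp_pos _)] at h2
    refine h2.trans ?_
    gcongr
    exact le_max_right _ _

theorem hasDerivAt_log_branch {F L : ℂ → ℂ} {U : Set ℂ} {z : ℂ} (hU : U ∈ 𝓝 z)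
    (hL : DifferentiableOn ℂ L U) (hexp : ∀ z ∈ U, exp (L z) = F z) :
    HasDerivAt L (logDeriv F z) z := by
  have h1 : DifferentiableAt ℂ L z := hL.differentiableAt hU
  have h2 : F =ᶠ[𝓝 z] fun z => exp (L z) := by
    filter_upwards [hU] with w hw using (hexp w hw).symm
  have h3 : logDeriv F z = deriv L z := by
    rw [logDeriv_apply, h2.deriv_eq, h1.hasDerivAt.cexp.deriv, h2.eq_of_nhds,
      mul_div_cancel_left₀ _ (exp_ne_zero _)]
  rw [h3]
  exact h1.hasDerivAt

/-- Integration by parts, with `L' = F'/F` on the sector. It supplies the factor `s` in `h(s) = s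
(e^{2πis} - 1)`. -/
theorem rayIntegral_logDeriv_eq {F L : ℂ → ℂ} {Ψ ε : ℝ} (hε : 0 < ε) (hF : Differentiable ℂ F)
    (hL : DifferentiableOn ℂ L (sector Ψ ε)) (hexp : ∀ z ∈ sector Ψ ε, exp (L z) = F z)
    (x₀ X : ℝ) (s : ℂ) :
    rayIntegral Ψ x₀ X s (logDeriv F) =
      exp (-s * (X + Ψ * I)) * L (exp (X + Ψ * I)) -
        exp (-s * (x₀ + Ψ * I)) * L (exp (x₀ + Ψ * I)) +
        s * ∫ x : ℝ in x₀..X, exp (-s * (x + Ψ * I)) * L (exp (x + Ψ * I)) := by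
  have hd : ∀ x : ℝ, HasDerivAt (fun x : ℝ => L (exp (x + Ψ * I)))
      (logDeriv F (exp (x + Ψ * I)) * exp (x + Ψ * I)) x := by
    intro x
    have h1 : HasDerivAt (fun x : ℝ => exp ((x : ℂ) + Ψ * I)) (exp (x + Ψ * I)) x := by
      simpa using ((hasDerivAt_id x).ofReal_comp.add_const (Ψ * I)).cexp
    exact HasDerivAt.comp x (hasDerivAt_log_branch (sector_mem_nhds_exp Ψ x hε) hL hexp) h1
  have hLc : Continuous fun x : ℝ => L (exp (x + Ψ * I)) :=
    continuous_iff_continuousAt.2 fun x => (hd x).continuousAt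
  have hFne : ∀ x : ℝ, F (exp (x + Ψ * I)) ≠ 0 := fun x => by
    rw [← hexp _ (exp_mem_sector Ψ x hε)]; exact exp_ne_zero _
  have hFd : Continuous (deriv F) := (hF.contDiff (n := 1)).continuous_deriv le_rfl
  have hlc : Continuous fun x : ℝ => logDeriv F (exp (x + Ψ * I)) := by
    simp only [logDeriv_apply]
    exact (hFd.comp (by fun_prop)).div (hF.continuous.comp (by fun_prop)) hFne
  have hd2 : ∀ x : ℝ, HasDerivAt (fun x : ℝ => exp (-s * (x + Ψ * I)) * L (exp (x + Ψ * I)))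
      (exp ((1 - s) * (x + Ψ * I)) * logDeriv F (exp (x + Ψ * I)) -
        s * (exp (-s * (x + Ψ * I)) * L (exp (x + Ψ * I)))) x := by
    intro x
    have h1 : HasDerivAt (fun x : ℝ => -s * ((x : ℂ) + Ψ * I)) (-s) x := by
      simpa using ((hasDerivAt_id x).ofReal_comp.add_const (Ψ * I)).const_mul (-s)
    convert! h1.cexp.mul (hd x) using 1
    rw [show (1 - s) * ((x : ℂ) + Ψ * I) = -s * (x + Ψ * I) + (x + Ψ * I) by ring, exp_add]
    ring
  have hi1 : Continuous fun x : ℝ =>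
      exp ((1 - s) * (x + Ψ * I)) * logDeriv F (exp (x + Ψ * I)) :=
    Continuous.mul (by fun_prop) hlc
  have hi2 : Continuous fun x : ℝ => s * (exp (-s * (x + Ψ * I)) * L (exp (x + Ψ * I))) :=
    continuous_const.mul (Continuous.mul (by fun_prop) hLc)
  have h := intervalIntegral.integral_eq_sub_of_hasDerivAt (a := x₀) (b := X) (fun x _ => hd2 x)
    ((hi1.sub hi2).intervalIntegrable _ _)
  rw [intervalIntegral.integral_sub (hi1.intervalIntegrable _ _) (hi2.intervalIntegrable _ _),
    intervalIntegral.integral_const_mul] at h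
  rw [rayIntegral]
  linear_combination h

theorem tendsto_integral_exp_mul_pow (Ψ x₀ : ℝ) {l : ℂ} (hl : 0 < l.re) (k : ℕ) :
    Tendsto (fun X : ℝ => ∫ x : ℝ in x₀..X, exp (-l * (x + Ψ * I)) * (x + Ψ * I) ^ k) atTop
      (𝓝 (k.factorial / l ^ (k + 1) - segmentIntegral k (x₀ + Ψ * I) l)) := by
  have hl0 : l ≠ 0 := by rintro rfl; simp at hl
  simp_rw [integral_exp_mul_pow hl0, ← exp_mul_laplacePoly_eq hl0]
  simpa using (tendsto_exp_mul_laplacePoly Ψ hl k).const_sub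
    (exp (-l * (x₀ + Ψ * I)) * laplacePoly k l (x₀ + Ψ * I))

theorem exists_tsum_eq_add_principal {a : ℕ → ℂ} {α Ψ ε : ℝ} {F : ℂ → ℂ} {m M N : ℕ}
    {d : ℕ → ℕ → ℂ} {δ : ℝ} (ha : IsZetaSequence a α Ψ ε) (hF : IsCharacteristicFunction a α F)
    (hL : HasLogExpansion F α Ψ ε m M N d δ) :
    ∃ A : ℂ → ℂ, DifferentiableOn ℂ A {s | α - (N : ℝ) / m - δ < s.re} ∧
      ∃ S : ℝ, ∀ s : ℂ, S < s.re → ∑' n, cutPowNeg Ψ (a n) s = A s + (2 * Real.pi * I)⁻¹ *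
        ∑ j ∈ Finset.range (N + 1), ∑ k ∈ Finset.range (M + 1), d j k * k.factorial *
          (s * (exp (2 * Real.pi * I * s) - 1)) / (s - (α - (j : ℝ) / m : ℝ)) ^ (k + 1) := by
  obtain ⟨L, hLd, hLexp, hLo⟩ := hL.expansion
  have hδ := hL.delta_pos
  have hε := ha.eps_pos
  obtain ⟨σ₀, hσ₀⟩ : ∃ σ₀, σ₀ = α - (N : ℝ) / m - δ := ⟨_, rfl⟩
  obtain ⟨x₀, hx₀⟩ : ∃ x₀ : ℝ, Real.exp x₀ < ‖a 0‖ := by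
    refine ⟨Real.log (‖a 0‖ / 2), ?_⟩
    have := ha.first_ne_zero
    rw [Real.exp_log (by positivity)]
    linarith
  have hσα : σ₀ < α := by
    have : (0 : ℝ) ≤ (N : ℝ) / m := by positivity
    linarith
  set β : ℕ → ℂ := fun j => (α - (j : ℝ) / m : ℝ)
  have hβ : ∀ j, (β j).re ≤ α := fun j => by
    have : (0 : ℝ) ≤ (j : ℝ) / m := by positivity
    simp only [β, ofReal_re]
    linarith
  set l : ℝ → ℂ := fun x => L (exp (x + Ψ * I))
  set g : ℝ → ℂ := fun x => ∑ j ∈ Finset.range (N + 1), ∑ k ∈ Finset.range (M + 1),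
    d j k * exp (β j * (x + Ψ * I)) * (x + Ψ * I) ^ k
  set r : ℝ → ℂ := fun x => l x - g x
  have hlc : Continuous l := by
    refine continuous_iff_continuousAt.2 fun x => ?_
    exact ContinuousAt.comp (f := fun x : ℝ => exp (x + Ψ * I)) (g := L)
      (hLd.differentiableAt (sector_mem_nhds_exp Ψ x hε)).continuousAt (by fun_prop)
  have hgc : Continuous g := by fun_prop
  have hrc : Continuous r := hlc.sub hgc
  have hrO : r =O[atTop] fun x => Real.exp (σ₀ * x) := by
    have h := (hLo.comp_tendsto (tendsto_exp_ray Ψ hε)).isBigO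
    refine (h.congr_left fun x => ?_).congr_right fun x => ?_
    · simp only [Function.comp_apply, argLog_exp]
      rfl
    · simp only [Function.comp_apply, norm_exp, ← hσ₀]
      rw [← Real.exp_mul]
      simp [mul_comm]
  obtain ⟨C, hC⟩ := exists_norm_le_mul_exp_of_isBigO hrc hrO x₀
  have hFarc : Continuous fun y : ℝ => logDeriv F (exp (x₀ + y * I)) := by
    simp only [logDeriv_apply]
    have hFd : Continuous (deriv F) := (hF.entire.contDiff (n := 1)).continuous_deriv le_rfl
    exact (hFd.comp (by fun_prop)).div (hF.entire.continuous.comp (by fun_prop)) fun y =>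
      hF.ne_zero fun n => (ha.exp_ne_of_lt hx₀ n y).symm
  obtain ⟨S, hS⟩ := exists_tendsto_keyhole ha hF hx₀
  set w₀ : ℂ := x₀ + Ψ * I
  set H : ℂ → ℂ := fun s => ∫ x : ℝ in Set.Ioi x₀, exp (-s * (x + Ψ * I)) * r x
  have hH : DifferentiableOn ℂ H {s | σ₀ < s.re} := differentiableOn_integral_Ioi hrc Ψ hC
  have hlim : ∀ s : ℂ, α < s.re →
      Tendsto (fun X : ℝ => rayIntegral Ψ x₀ X s (logDeriv F)) atTop
        -- The `0` is the limit of the boundary term at infinity, which vanishes because `L` grows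
        -- at most like `|z| ^ α` times a power of `ln |z|` along the ray and `Re s > α`.
        (𝓝 (0 - exp (-s * w₀) * l x₀ + s *
          (∑ j ∈ Finset.range (N + 1), ∑ k ∈ Finset.range (M + 1),
            d j k * (k.factorial / (s - β j) ^ (k + 1) - segmentIntegral k w₀ (s - β j))
            + H s))) := by
    intro s hs
    have hsl : ∀ j, 0 < (s - β j).re := fun j => by
      rw [sub_re]; linarith [hβ j]
    have hterm : ∀ (j k : ℕ) (x : ℝ),
        exp (-s * (x + Ψ * I)) * (d j k * exp (β j * (x + Ψ * I)) * (x + Ψ * I) ^ k)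
        = d j k * (exp (-(s - β j) * (x + Ψ * I)) * (x + Ψ * I) ^ k) := by
      intro j k x
      rw [show -(s - β j) * ((x : ℂ) + Ψ * I) = -s * (x + Ψ * I) + β j * (x + Ψ * I) by ring,
        exp_add]
      ring
    have hgs : ∀ x : ℝ, exp (-s * (x + Ψ * I)) * g x =
        ∑ j ∈ Finset.range (N + 1), ∑ k ∈ Finset.range (M + 1),
          d j k * (exp (-(s - β j) * (x + Ψ * I)) * (x + Ψ * I) ^ k) := by
      intro x
      simp only [g, Finset.mul_sum, hterm]
    have hbdry : Tendsto (fun X : ℝ => exp (-s * (X + Ψ * I)) * l X) atTop (𝓝 0) := by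
      have h1 : Tendsto (fun X : ℝ => exp (-s * (X + Ψ * I)) * g X) atTop (𝓝 0) := by
        simp_rw [hgs]
        have := tendsto_finsetSum (Finset.range (N + 1)) fun j _ =>
          tendsto_finsetSum (Finset.range (M + 1)) fun k _ =>
            (tendsto_exp_mul_ray_pow Ψ (hsl j) k).const_mul (d j k)
        simpa using this
      have h2 : Tendsto (fun X : ℝ => exp (-s * (X + Ψ * I)) * r X) atTop (𝓝 0) := by
        have h3 : Tendsto (fun X : ℝ => Real.exp (s.im * Ψ) * C * Real.exp ((σ₀ - s.re) * X))
            atTop (𝓝 0) := by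
          rw [← mul_zero (Real.exp (s.im * Ψ) * C)]
          refine (Real.tendsto_exp_atBot.comp ?_).const_mul _
          exact tendsto_id.const_mul_atTop_of_neg (by linarith)
        refine squeeze_zero_norm' ?_ h3
        filter_upwards [eventually_gt_atTop x₀] with x hx
        rw [norm_mul, norm_exp_neg_mul_ray]
        calc _ ≤ Real.exp (s.im * Ψ) * Real.exp (-s.re * x) * (C * Real.exp (σ₀ * x)) := by
              gcongr; exact hC x hx
          _ = Real.exp (s.im * Ψ) * C * (Real.exp (-s.re * x) * Real.exp (σ₀ * x)) := by ring
          _ = _ := by rw [← Real.exp_add]; ring_nf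
      have := h1.add h2
      simp only [r, add_zero] at this
      exact this.congr fun x => by ring
    have hint : Tendsto (fun X : ℝ => ∫ x : ℝ in x₀..X, exp (-s * (x + Ψ * I)) * l x) atTop
        (𝓝 (∑ j ∈ Finset.range (N + 1), ∑ k ∈ Finset.range (M + 1),
            d j k * (k.factorial / (s - β j) ^ (k + 1) - segmentIntegral k w₀ (s - β j))
            + H s)) := by
      have h1 : Tendsto (fun X : ℝ => ∫ x : ℝ in x₀..X, exp (-s * (x + Ψ * I)) * r x) atTop
          (𝓝 (H s)) :=
        intervalIntegral_tendsto_integral_Ioi x₀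
          (integrableOn_exp_mul_of_norm_le hrc Ψ hC (by linarith)) tendsto_id
      have h2 := tendsto_finsetSum (Finset.range (N + 1)) fun j _ =>
          tendsto_finsetSum (Finset.range (M + 1)) fun k _ =>
            (tendsto_integral_exp_mul_pow Ψ x₀ (hsl j) k).const_mul (d j k)
      refine (h2.add h1).congr fun X => ?_
      have hc : ∀ j k : ℕ, Continuous fun x : ℝ =>
          d j k * (exp (-(s - β j) * (x + Ψ * I)) * (x + Ψ * I) ^ k) := by
        intro j k; fun_prop
      have h3 : ∫ x : ℝ in x₀..X, exp (-s * (x + Ψ * I)) * g x =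
          ∑ j ∈ Finset.range (N + 1), ∑ k ∈ Finset.range (M + 1),
            d j k * ∫ x : ℝ in x₀..X, exp (-(s - β j) * (x + Ψ * I)) * (x + Ψ * I) ^ k := by
        simp_rw [hgs]
        rw [intervalIntegral.integral_finsetSum fun j _ =>
          (continuous_finsetSum _ fun k _ => hc j k).intervalIntegrable _ _]
        refine Finset.sum_congr rfl fun j _ => ?_
        rw [intervalIntegral.integral_finsetSum fun k _ => (hc j k).intervalIntegrable _ _]
        refine Finset.sum_congr rfl fun k _ => ?_
        rw [intervalIntegral.integral_const_mul]
      have hc1 : Continuous fun x : ℝ => exp (-s * (x + Ψ * I)) * g x :=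
        Continuous.mul (by fun_prop) hgc
      have hc2 : Continuous fun x : ℝ => exp (-s * (x + Ψ * I)) * r x :=
        Continuous.mul (by fun_prop) hrc
      rw [← h3, ← intervalIntegral.integral_add (hc1.intervalIntegrable _ _)
        (hc2.intervalIntegrable _ _)]
      refine intervalIntegral.integral_congr fun x _ => ?_
      simp only [r]
      ring
    refine ((hbdry.sub_const (exp (-s * w₀) * l x₀)).add (hint.const_mul s)).congr fun X => ?_
    exact (rayIntegral_logDeriv_eq hε hF.entire hLd hLexp x₀ X s).symm
  -- `A` gathers everything holomorphic: the boundary term at `x₀`, the remainder integral `H`, the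
  -- segment integrals and the small arc.
  refine ⟨fun s => (2 * Real.pi * I)⁻¹ * ((exp (2 * Real.pi * I * s) - 1) *
    (- exp (-s * w₀) * l x₀ + s * (H s - ∑ j ∈ Finset.range (N + 1),
      ∑ k ∈ Finset.range (M + 1), d j k * segmentIntegral k w₀ (s - β j)))
      - arcIntegral Ψ x₀ s (logDeriv F)), ?_, max S α, fun s hs => ?_⟩
  · rw [← hσ₀]
    have h1 : Differentiable ℂ fun s => arcIntegral Ψ x₀ s (logDeriv F) :=
      differentiable_arcIntegral Ψ x₀ hFarc
    have h2 : Differentiable ℂ fun s => ∑ j ∈ Finset.range (N + 1),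
        ∑ k ∈ Finset.range (M + 1), d j k * segmentIntegral k w₀ (s - β j) :=
      Differentiable.fun_sum fun j _ => Differentiable.fun_sum fun k _ =>
        ((differentiable_segmentIntegral k w₀).comp (differentiable_id.sub_const _)).const_mul _
    have h2' := h2.differentiableOn (s := {s : ℂ | σ₀ < s.re})
    have h1' := h1.differentiableOn (s := {s : ℂ | σ₀ < s.re})
    refine DifferentiableOn.const_mul (DifferentiableOn.sub ?_ h1') _
    refine DifferentiableOn.mul (by fun_prop) (DifferentiableOn.add (by fun_prop) ?_)
    exact DifferentiableOn.mul (by fun_prop) (hH.sub h2')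
  · have hs1 : S < s.re := (le_max_left _ _).trans_lt hs
    have hs2 : α < s.re := (le_max_right _ _).trans_lt hs
    have h1 := tendsto_nhds_unique (hS s hs1)
      (((hlim s hs2).const_mul (exp (2 * Real.pi * I * s) - 1)).sub_const _)
    have hpi : (2 * Real.pi * I : ℂ) ≠ 0 := two_pi_I_ne_zero
    rw [← mul_right_inj' hpi, h1]
    have h2 : ∑ j ∈ Finset.range (N + 1), ∑ k ∈ Finset.range (M + 1), d j k * k.factorial *
          (s * (exp (2 * Real.pi * I * s) - 1)) / (s - (α - (j : ℝ) / m : ℝ)) ^ (k + 1) =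
        (s * (exp (2 * Real.pi * I * s) - 1)) * ∑ j ∈ Finset.range (N + 1),
          ∑ k ∈ Finset.range (M + 1), d j k * (k.factorial / (s - β j) ^ (k + 1)) := by
      simp only [Finset.mul_sum]
      refine Finset.sum_congr rfl fun j _ => Finset.sum_congr rfl fun k _ => ?_
      ring
    beta_reduce
    rw [← mul_add (2 * Real.pi * I : ℂ)⁻¹, mul_inv_cancel_left₀ hpi, h2]
    simp only [mul_sub, Finset.sum_sub_distrib]
    ring

end ZetaSeq

/-! ### Residues and uniqueness of the continuation. -/

namespace ZetaSeq

open Filter Topology Complex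

/-- Cauchy's formula for the `k`-th derivative at the centre: the factor `k!` in the numerator
cancels its denominator, and `g` integrates to `0` over small circles. -/
theorem hasResidueAt_of_eventuallyEq {f g h : ℂ → ℂ} {b : ℂ} {n : ℕ} {c : ℕ → ℂ}
    (hg : ∀ᶠ s in 𝓝 b, DifferentiableAt ℂ g s) (hh : Differentiable ℂ h)
    (hf : f =ᶠ[𝓝[≠] b]
      fun s => g s + ∑ k ∈ Finset.range n, c k * k.factorial * h s / (s - b) ^ (k + 1)) :
    HasResidueAt f b (∑ k ∈ Finset.range n, c k * iteratedDeriv k h b) := by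
  rw [EventuallyEq, eventually_nhdsWithin_iff] at hf
  obtain ⟨ρ, hρ, hball⟩ := Metric.eventually_nhds_iff.1 (hg.and hf)
  filter_upwards [Ioo_mem_nhdsGT hρ] with r hr
  obtain ⟨hr0, hrρ⟩ := hr
  have hgd : DifferentiableOn ℂ g (Metric.closedBall b r) := fun z hz =>
    (hball ((Metric.mem_closedBall.1 hz).trans_lt hrρ)).1.differentiableWithinAt
  have hne : ∀ z ∈ Metric.sphere b r, z - b ≠ 0 := fun z hz =>
    sub_ne_zero.2 (Metric.ne_of_mem_sphere hz hr0.ne')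
  have hci : ∀ k ∈ Finset.range n,
      CircleIntegrable (fun s => c k * k.factorial * ((1 / (s - b) ^ (k + 1)) • h s)) b r := by
    intro k _
    refine ContinuousOn.circleIntegrable hr0.le (ContinuousOn.mul continuousOn_const
      (ContinuousOn.smul (ContinuousOn.div continuousOn_const (by fun_prop)
        fun z hz => pow_ne_zero _ (hne z hz)) hh.continuous.continuousOn))
  have hcg : CircleIntegrable g b r := ContinuousOn.circleIntegrable hr0.le
    (hgd.continuousOn.mono Metric.sphere_subset_closedBall)
  have hcs : CircleIntegrable (fun s => ∑ k ∈ Finset.range n,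
      c k * k.factorial * ((1 / (s - b) ^ (k + 1)) • h s)) b r :=
    CircleIntegrable.fun_sum _ hci
  have hint : (∮ z in C(b, r), f z) = ∮ z in C(b, r), (g z + ∑ k ∈ Finset.range n,
      c k * k.factorial * ((1 / (z - b) ^ (k + 1)) • h z)) := by
    refine circleIntegral.integral_congr hr0.le fun z hz => ?_
    rw [(hball ((Metric.mem_sphere.1 hz).trans_lt hrρ)).2 (Metric.ne_of_mem_sphere hz hr0.ne')]
    congr 1
    refine Finset.sum_congr rfl fun k _ => ?_
    rw [smul_eq_mul]
    ring
  have hg0 : (∮ z in C(b, r), g z) = 0 :=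
    circleIntegral_eq_zero_of_differentiable_on_off_countable hr0.le Set.countable_empty
      hgd.continuousOn fun z hz =>
        (hball ((Metric.mem_ball.1 hz.1).trans hrρ)).1
  rw [hint, circleIntegral.integral_add hcg hcs, hg0, zero_add,
    circleIntegral.integral_fun_sum hci, Finset.mul_sum]
  refine Finset.sum_congr rfl fun k _ => ?_
  rw [circleIntegral.integral_const_mul,
    DifferentiableOn.circleIntegral_one_div_sub_center_pow_smul hr0 k hh.differentiableOn,
    smul_eq_mul]
  have h1 := two_pi_I_ne_zero
  have h2 : (k.factorial : ℂ) ≠ 0 := by exact_mod_cast k.factorial_ne_zero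
  field_simp

theorem deriv_mul_exp_sub_one (c : ℂ) :
    deriv (fun s : ℂ => s * (exp (c * s) - 1)) = fun s => (c * s + 1) * exp (c * s) - 1 := by
  funext s
  have h1 : HasDerivAt (fun s => c * s) c s := by simpa using (hasDerivAt_id s).const_mul c
  have h2 := (hasDerivAt_id s).mul (h1.cexp.sub_const 1)
  refine h2.deriv.trans ?_
  simp only [id]
  ring

/-- From the second derivative on, the summand `-s` has disappeared and only Leibniz's rule for `s
e^{cs}` remains. This is why orders `0` and `1` have terms of their own in `residueFormula`. -/
theorem iteratedDeriv_mul_exp_sub_one (c : ℂ) (k : ℕ) :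
    iteratedDeriv (k + 2) (fun s : ℂ => s * (exp (c * s) - 1)) =
      fun s => c ^ (k + 1) * exp (c * s) * (c * s + (k + 2 : ℕ)) := by
  induction k with
  | zero =>
    rw [iteratedDeriv_succ, iteratedDeriv_one, deriv_mul_exp_sub_one]
    funext s
    have h1 : HasDerivAt (fun s => c * s) c s := by simpa using (hasDerivAt_id s).const_mul c
    refine (((h1.add_const 1).mul h1.cexp).sub_const 1).deriv.trans ?_
    push_cast
    ring
  | succ k ih =>
    rw [iteratedDeriv_succ, ih]
    funext s
    have h1 : HasDerivAt (fun s => c * s) c s := by simpa using (hasDerivAt_id s).const_mul c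
    refine ((h1.cexp.const_mul (c ^ (k + 1))).mul (h1.add_const _)).deriv.trans ?_
    push_cast
    ring

theorem sum_range_eq_add_add_sum_Icc {f : ℕ → ℂ} {M : ℕ} (hM : 2 ≤ M) :
    ∑ k ∈ Finset.range (M + 1), f k = f 0 + f 1 + ∑ k ∈ Finset.Icc 2 M, f k := by
  have h : Finset.Icc 2 M = Finset.Ico 2 (M + 1) := by ext; simp
  rw [h, Finset.range_eq_Ico, Finset.sum_eq_sum_Ico_succ_bot (by omega),
    Finset.sum_eq_sum_Ico_succ_bot (by omega)]
  ring

theorem residueFormula_eq_sum (M : ℕ) (c : ℕ → ℂ) (b : ℂ) :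
    residueFormula M c b = ∑ k ∈ Finset.range (M + 1), (2 * Real.pi * I)⁻¹ * c k *
      iteratedDeriv k (fun s : ℂ => s * (exp (2 * Real.pi * I * s) - 1)) b := by
  have e1 : iteratedDeriv 1 (fun s : ℂ => s * (exp (2 * Real.pi * I * s) - 1)) b =
      (2 * Real.pi * I * b + 1) * exp (2 * Real.pi * I * b) - 1 := by
    rw [iteratedDeriv_one, deriv_mul_exp_sub_one]
  have hpi := two_pi_I_ne_zero
  rcases (by omega : M = 0 ∨ M = 1 ∨ 2 ≤ M) with rfl | rfl | hM
  · norm_num [residueFormula, heaviside]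
    ring
  · rw [Finset.sum_range_succ, Finset.sum_range_one, e1]
    norm_num [residueFormula, heaviside]
    ring
  · have hM' : (2 : ℝ) ≤ M := by exact_mod_cast hM
    rw [sum_range_eq_add_add_sum_Icc hM, e1, residueFormula, heaviside, heaviside, heaviside,
      if_pos (by positivity), if_pos (by linarith), if_pos (by linarith), iteratedDeriv_zero,
      Finset.mul_sum]
    congr 1
    · ring
    · refine Finset.sum_congr rfl fun k hk => ?_
      obtain ⟨i, rfl⟩ : ∃ i, k = i + 2 := ⟨k - 2, by have := (Finset.mem_Icc.1 hk).1; omega⟩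
      rw [iteratedDeriv_mul_exp_sub_one, show i + 2 - 1 = i + 1 by omega]
      ring

theorem residueFormula_zero {M : ℕ} (hM : 2 ≤ M) (c : ℕ → ℂ) :
    residueFormula M c 0 =
      ∑ k ∈ Finset.Icc 2 M, c k * (2 * Real.pi * I) ^ (k - 2) * (k : ℂ) := by
  have hM' : (2 : ℝ) ≤ M := by exact_mod_cast hM
  have hpi := two_pi_I_ne_zero
  rw [residueFormula, heaviside, heaviside, heaviside, if_pos (by positivity),
    if_pos (by linarith), if_pos (by linarith), Finset.mul_sum]
  simp only [mul_zero, zero_add, exp_zero, mul_one, sub_self, add_zero]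
  refine Finset.sum_congr rfl fun k hk => ?_
  obtain ⟨i, rfl⟩ : ∃ i, k = i + 2 := ⟨k - 2, by have := (Finset.mem_Icc.1 hk).1; omega⟩
  rw [show i + 2 - 1 = i + 1 by omega, show i + 2 - 2 = i by omega, pow_succ]
  field_simp

/-- The difference has infinite order at one point, hence at all points. Punctured neighbourhoods
are needed because the values at poles are arbitrary. -/
theorem MeromorphicOn.eventuallyEq_of_isPreconnected {f g : ℂ → ℂ} {U : Set ℂ}
    (hf : MeromorphicOn f U) (hg : MeromorphicOn g U) (hU : IsPreconnected U) {x y : ℂ}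
    (hx : x ∈ U) (hy : y ∈ U) (h : f =ᶠ[𝓝[≠] x] g) : f =ᶠ[𝓝[≠] y] g := by
  by_contra hc
  refine MeromorphicOn.meromorphicOrderAt_ne_top_of_isPreconnected (hf.sub hg) hU hy hx ?_ ?_
  · rw [Ne, meromorphicOrderAt_eq_top_iff]
    intro h1
    exact hc (h1.mono fun z hz => sub_eq_zero.1 hz)
  · rw [meromorphicOrderAt_eq_top_iff]
    exact h.mono fun z hz => by simp [hz]

theorem exists_continuation_and_hasResidueAt (a : ℕ → ℂ) (α Ψ ε : ℝ) (F : ℂ → ℂ) (m M N : ℕ) (d : ℕ → ℕ → ℂ) (δ : ℝ)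
    (hm : 0 < m)
    (ha : IsZetaSequence a α Ψ ε)
    (hF : IsCharacteristicFunction a α F)
    (hL : HasLogExpansion F α Ψ ε m M N d δ) :
    (∃ Z : ℂ → ℂ, IsZetaContinuation a α Ψ (α - (N : ℝ) / m - δ) Z) ∧
    ∀ Z : ℂ → ℂ, IsZetaContinuation a α Ψ (α - (N : ℝ) / m - δ) Z →
      ∀ j : ℕ, j ≤ N →
        HasResidueAt Z ((α - (j : ℝ) / m : ℝ) : ℂ)
          (residueFormula M (d j) ((α - (j : ℝ) / m : ℝ) : ℂ)) := by
  obtain ⟨A, hA, S, hS⟩ := exists_tsum_eq_add_principal ha hF hL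
  have hδ := hL.delta_pos
  have hm' : (0 : ℝ) < m := by exact_mod_cast hm
  set σ₀ := α - (N : ℝ) / m - δ
  have hσα : σ₀ < α := by
    have : (0 : ℝ) ≤ (N : ℝ) / m := by positivity
    simp only [σ₀]
    linarith
  set h : ℂ → ℂ := fun s => s * (exp (2 * Real.pi * I * s) - 1)
  have hh : Differentiable ℂ h := by fun_prop
  set U : Set ℂ := {s | σ₀ < s.re}
  have hUo : IsOpen U := isOpen_lt continuous_const continuous_re
  have hUc : IsPreconnected U := (convex_halfSpace_re_gt σ₀).isPreconnected
  set T : ℕ → ℂ → ℂ := fun j s => ∑ k ∈ Finset.range (M + 1),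
    (2 * Real.pi * I)⁻¹ * d j k * k.factorial * h s / (s - (α - (j : ℝ) / m : ℝ)) ^ (k + 1)
  have hTd : ∀ (j : ℕ) (s : ℂ), s ≠ ((α - (j : ℝ) / m : ℝ) : ℂ) → DifferentiableAt ℂ (T j) s := by
    intro j s hs
    refine DifferentiableAt.fun_sum fun k _ => ?_
    exact DifferentiableAt.div (by fun_prop) (by fun_prop) (pow_ne_zero _ (sub_ne_zero.2 hs))
  have hTm : ∀ j s, MeromorphicAt (T j) s := by
    intro j s
    refine MeromorphicAt.fun_sum fun k _ => ?_
    refine MeromorphicAt.div ?_ ?_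
    · exact (Differentiable.analyticAt (by fun_prop) s).meromorphicAt
    · exact (Differentiable.analyticAt (by fun_prop) s).meromorphicAt
  set Z₀ : ℂ → ℂ := fun s => A s + ∑ j ∈ Finset.range (N + 1), T j s
  have hZS : ∀ s : ℂ, S < s.re → ∑' n, cutPowNeg Ψ (a n) s = Z₀ s := by
    intro s hs
    rw [hS s hs]
    simp only [Z₀, T, Finset.mul_sum]
    congr 1
    refine Finset.sum_congr rfl fun j _ => Finset.sum_congr rfl fun k _ => ?_
    simp only [h]
    ring
  have hAd : ∀ s ∈ U, DifferentiableAt ℂ A s := fun s hs => hA.differentiableAt (hUo.mem_nhds hs)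
  have hZ₀m : MeromorphicOn Z₀ U := by
    intro s hs
    refine MeromorphicAt.add ?_ (MeromorphicAt.fun_sum fun j _ => hTm j s)
    exact (hA.analyticAt (hUo.mem_nhds hs)).meromorphicAt
  set V : Set ℂ := {s | α < s.re}
  have hVo : IsOpen V := isOpen_lt continuous_const continuous_re
  have hVc : IsPreconnected V := (convex_halfSpace_re_gt α).isPreconnected
  have hZ₀d : DifferentiableOn ℂ Z₀ V := by
    intro s hs
    refine DifferentiableAt.differentiableWithinAt ?_
    refine (hAd s (hσα.trans hs)).add (DifferentiableAt.fun_sum fun j _ => hTd j s ?_)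
    rintro rfl
    have h1 : (0 : ℝ) ≤ (j : ℝ) / m := by positivity
    simp only [V, Set.mem_ofPred_eq, ofReal_re] at hs
    linarith
  obtain ⟨p, hp⟩ : ∃ p : ℝ, p = max S α + 1 := ⟨_, rfl⟩
  have hpS : S < p := by have := le_max_left S α; linarith
  have hpα : α < p := by have := le_max_right S α; linarith
  have hpV : (p : ℂ) ∈ V := by simpa [V] using hpα
  -- The formula is known only for `Re s > S`. Both sides are holomorphic for `Re s > α`, since
  -- every `β_j ≤ α`, so the identity theorem extends it.
  have hZV : Set.EqOn (fun s => ∑' n, cutPowNeg Ψ (a n) s) Z₀ V := by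
    refine (ha.differentiableOn_tsum.analyticOnNhd hVo).eqOn_of_preconnected_of_eventuallyEq
      (hZ₀d.analyticOnNhd hVo) hVc hpV ?_
    have : {s : ℂ | S < s.re} ∈ 𝓝 (p : ℂ) :=
      (isOpen_lt continuous_const continuous_re).mem_nhds (by simpa using hpS)
    filter_upwards [this] with s hs using hZS s hs
  refine ⟨⟨Z₀, hZ₀m, fun s hs => ?_⟩, fun Z hZ j hj => ?_⟩
  · rw [← hZV hs]
    exact (ha.summable_cutPowNeg hs).hasSum
  · set b : ℂ := ((α - (j : ℝ) / m : ℝ) : ℂ)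
    have hbU : b ∈ U := by
      have : (j : ℝ) / m ≤ (N : ℝ) / m := by gcongr
      simp only [U, b, σ₀, Set.mem_ofPred_eq, ofReal_re]
      linarith
    have hZZ : Z =ᶠ[𝓝[≠] b] Z₀ := by
      refine MeromorphicOn.eventuallyEq_of_isPreconnected hZ.meromorphic hZ₀m hUc
        (x := (p : ℂ)) (hσα.trans hpV) hbU ?_
      refine (Filter.Eventually.filter_mono nhdsWithin_le_nhds ?_)
      filter_upwards [hVo.mem_nhds hpV] with s hs
      rw [← hZV hs]
      exact ((hZ.hasSum s hs).tsum_eq).symm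
    rw [residueFormula_eq_sum]
    -- The principal parts at the other points `β_i` are holomorphic near `β_j`, as the `β_i` are
    -- distinct, and are absorbed into `g`.
    refine hasResidueAt_of_eventuallyEq (h := h)
      (g := fun s => A s + ∑ i ∈ (Finset.range (N + 1)).erase j, T i s) ?_ hh ?_
    · have h1 : ∀ i ∈ (Finset.range (N + 1)).erase j,
          ∀ᶠ s in 𝓝 b, s ≠ ((α - (i : ℝ) / m : ℝ) : ℂ) := by
        intro i hi
        refine isOpen_ne.mem_nhds fun he => (Finset.mem_erase.1 hi).1 ?_
        have h2 : α - (j : ℝ) / m = α - (i : ℝ) / m := ofReal_injective he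
        have h3 : (j : ℝ) / m = (i : ℝ) / m := by linarith
        rw [div_left_inj' hm'.ne'] at h3
        exact_mod_cast h3.symm
      filter_upwards [(Filter.eventually_all_finset _).2 h1, hUo.mem_nhds hbU] with s hs hsU
      exact (hAd s hsU).add (DifferentiableAt.fun_sum fun i hi => hTd i s (hs i hi))
    · refine hZZ.trans (Eventually.of_forall fun s => ?_)
      simp only [Z₀]
      rw [← Finset.add_sum_erase _ _ (Finset.mem_range.2 (by omega : j < N + 1))]
      simp only [T, b]
      ring

end ZetaSeq

theorem mainTheorem5 (a : ℕ → ℂ) (α Ψ ε : ℝ) (F : ℂ → ℂ) (m M N : ℕ) (d : ℕ → ℕ → ℂ) (δ : ℝ)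
    (hm : 0 < m)
    (ha : ZetaSeq.IsZetaSequence a α Ψ ε)
    (hF : ZetaSeq.IsCharacteristicFunction a α F)
    (hL : ZetaSeq.HasLogExpansion F α Ψ ε m M N d δ) :
    (∃ Z : ℂ → ℂ, ZetaSeq.IsZetaContinuation a α Ψ (α - (N : ℝ) / m - δ) Z) ∧
    ∀ Z : ℂ → ℂ, ZetaSeq.IsZetaContinuation a α Ψ (α - (N : ℝ) / m - δ) Z →
      (∀ j : ℕ, j ≤ N →
        ZetaSeq.HasResidueAt Z ((α - (j : ℝ) / m : ℝ) : ℂ)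
          (ZetaSeq.residueFormula M (d j) ((α - (j : ℝ) / m : ℝ) : ℂ))) ∧
      (2 ≤ M → ∀ j' : ℕ, j' ≤ N → α - (j' : ℝ) / m = 0 →
        ZetaSeq.HasResidueAt Z 0
          (∑ k ∈ Finset.Icc 2 M,
            d j' k * (2 * (Real.pi : ℂ) * Complex.I) ^ (k - 2) * (k : ℂ))) := by
  obtain ⟨hex, hres⟩ := ZetaSeq.exists_continuation_and_hasResidueAt a α Ψ ε F m M N d δ hm ha hF hL
  refine ⟨hex, fun Z hZ => ⟨hres Z hZ, fun hM j hj h0 => ?_⟩⟩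
  have h := hres Z hZ j hj
  rwa [h0, Complex.ofReal_zero, ZetaSeq.residueFormula_zero hM] at h
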